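/- **Setting.** Matrices are infinite complex matrices, and products are given by the usual row-by-column series. An infinite matrix $X\in\mathbb C^{\mathbb N\times\mathbb N}$ *has a Jordan decomposition with infinitely many distinct eigenvalues* if $$X=U\Big(\bigoplus_{k=1}^{\infty}\bigoplus_{i=1}^{\alpha_k}J_{m_{k,i}}(\lambda_k)\Big)U^{-1},$$ where the $\lambda_k\in\mathbb C$ ($k\ge 1$) are pairwise distinct, $\alpha_k\ge 1$ and $m_{k,i}\ge 1$ are integers, $J_m(\lambda)$ is the $m\times m$ upper triangular Jordan block, $U$ is an infinite matrix (its columns indexed by the positions of the direct sum) with two-sided inverse $U^{-1}$, and the entries of $UU^{-1}$, $U^{-1}U$ and of the product for $X$ are given by convergent series. Write $J$ for the direct sum. Put $P_{k,i}=U I_{k,i}U^{-1}$ and $N_{k,i}=U\acute J_{k,i}U^{-1}$, where $I_{k,i}$ (resp. $\acute J_{k,i}$) is the identity (resp. the nilpotent Jordan block $J_{m_{k,i}}(0)$) on the block $(k,i)$ and $0$ on all other blocks. Let $r\ge 1$, let $R_1,\dots,R_r\in(0,\infty]$, let $f$ be analytic on the polydisc $\{|z_l|<R_l,\ l=1,\dots,r\}$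 with power series $f(z)=\sum_{n\in\mathbb N^r}a_n z_1^{n_1}\cdots z_r^{n_r}$ at the origin, and let $X_1,\dots,X_r$ be infinite matrices with such Jordan decompositions, with data $U_l,J_l,\lambda_{k_l},\alpha_{k_l},m_{k_l,i_l},P_{k_l,i_l},N_{k_l,i_l}$, and with $|\lambda_{k_l}|<R_l$ for all $l$ and $k_l$. Define $$f(X_1,\dots,X_r)=\sum_{n\in\mathbb N^r}a_n X_1^{n_1}\cdots X_r^{n_r}$$ with entrywise (unconditional) convergence. Let $|A|$ denote the matrix of absolute values of the entries of $A$. Say that *absolute convergence holds* if, for all $n\in\mathbb N^r$, all entries of $\prod_{l=1}^r\big(|U_l|(1+|J_l|)|U_l^{-1}|\big)^{n_l}$ are finite, and all entries of $\sum_{n}|a_n|\prod_{l=1}^r|U_l||J_l|^{n_l}|U_l^{-1}|$ are finite (products ordered by increasing $l$). **Theorem.** (1) If all the matrices $U_l,U_l^{-1}$ are column-finite (every column has finitely many nonzero entries), or all of them are row-finite, then absolute convergence holds. (2) If absolute convergence holds, then $f(X_1,\dots,X_r)$ exists and $$\begin{aligned} f(X_1,\dots,X_r)=&\sum_{k_1,\dots,k_r=1}^{\infty}\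 \sum_{i_1=1}^{\alpha_{k_1}}\cdots\sum_{i_r=1}^{\alpha_{k_r}} f(\lambda_{k_1},\dots,\lambda_{k_r})\,P_{k_1,i_1}\cdots P_{k_r,i_r}\\ &+\sum_{k_1,\dots,k_r=1}^{\infty}\ \sum_{i_1=1}^{\alpha_{k_1}}\cdots\sum_{i_r=1}^{\alpha_{k_r}}\ \sum_{\kappa=1}^{r-1}\ \sum_{\substack{S\subseteq\{1,\dots,r\}\\|S|=\kappa}}\ \sum_{\substack{1\le q_l\le m_{k_l,i_l}-1\\ (l\in S)}} \frac{\big(\prod_{l\in S}\partial_l^{q_l}\big)f(\lambda_{k_1},\dots,\lambda_{k_r})}{\prod_{l\in S}q_l!}\ Y_1\cdots Y_r\\ &+\sum_{k_1,\dots,k_r=1}^{\infty}\ \sum_{i_1=1}^{\alpha_{k_1}}\cdots\sum_{i_r=1}^{\alpha_{k_r}}\ \sum_{q_1=1}^{m_{k_1,i_1}-1}\cdots\sum_{q_r=1}^{m_{k_r,i_r}-1} \frac{\partial_1^{q_1}\cdots\partial_r^{q_r}f(\lambda_{k_1},\dots,\lambda_{k_r})}{q_1!\cdots q_r!}\,N_{k_1,i_1}^{q_1}\cdots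 N_{k_r,i_r}^{q_r}, \end{aligned}$$ where $Y_l=N_{k_l,i_l}^{q_l}$ for $l\in S$ and $Y_l=P_{k_l,i_l}$ for $l\notin S$, and each of the three infinite sums over $(k_l,i_l)_l$ converges unconditionally in every entry. For $r=1$ this reads $f(X)=\sum_{k}\big[\sum_{i}f(\lambda_k)P_{k,i}+\sum_i\sum_{q=1}^{m_{k,i}-1}\frac{f^{(q)}(\lambda_k)}{q!}N_{k,i}^q\big]$, and for $r=2$ the middle sum consists of the terms $\frac{\partial_2^{q_2}f}{q_2!}P_{k_1,i_1}N_{k_2,i_2}^{q_2}$ and $\frac{\partial_1^{q_1}f}{q_1!}N_{k_1,i_1}^{q_1}P_{k_2,i_2}$. -/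

import Mathlib

open scoped ENNReal

namespace InfMat

noncomputable section

/-! Calculus of (possibly infinite) matrices.  All products are given by the usual row-by-column
series. -/

/-- The product of two possibly infinite matrices, `(A B) a b = ∑ c, A a c * B c b`. -/
def mul {R : Type*} [Semiring R] [TopologicalSpace R] {ι κ ν : Type*}
    (A : Matrix ι κ R) (B : Matrix κ ν R) : Matrix ι ν R :=
  fun a b => ∑' c, A a c * B c b

/-- `C` is the product of `A` and `B`, all the row-by-column series being convergent. -/
def IsMul {ι κ ν : Type*} (A : Matrix ι κ ℂ) (B : Matrix κ ν ℂ) (C : Matrix ι ν ℂ) : Prop :=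
  ∀ a b, HasSum (fun c => A a c * B c b) (C a b)

/-- Powers of a possibly infinite square matrix. -/
def pow {R : Type*} [Semiring R] [TopologicalSpace R] {ι : Type*} [DecidableEq ι]
    (A : Matrix ι ι R) : ℕ → Matrix ι ι R
  | 0 => 1
  | n + 1 => mul (pow A n) A

/-- The ordered product `A 0 * A 1 * ⋯ * A (r - 1)`. -/
def prod {R : Type*} [Semiring R] [TopologicalSpace R] {ι : Type*} [DecidableEq ι] {r : ℕ}
    (A : Fin r → Matrix ι ι R) : Matrix ι ι R :=
  (List.ofFn A).foldr mul 1

/-- The matrix of absolute values of the entries, with values in `[0, ∞]`. -/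
def abs {ι κ : Type*} (A : Matrix ι κ ℂ) : Matrix ι κ ℝ≥0∞ := A.map fun z => ‖z‖ₑ

/-- Every column of `A` has finitely many nonzero entries. -/
def ColumnFinite {ι κ : Type*} (A : Matrix ι κ ℂ) : Prop := ∀ b, {a | A a b ≠ 0}.Finite

/-- Every row of `A` has finitely many nonzero entries. -/
def RowFinite {ι κ : Type*} (A : Matrix ι κ ℂ) : Prop := ∀ a, {b | A a b ≠ 0}.Finite

/-- The upper triangular Jordan block `J_m(c)`. -/
def jordanBlock (m : ℕ) (c : ℂ) : Matrix (Fin m) (Fin m) ℂ :=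
  fun i j => if i = j then c else if (i : ℕ) + 1 = j then 1 else 0

/-- A Jordan decomposition `X = U (⨁ₖ ⨁ᵢ J_{m k i}(ev k)) U⁻¹` of an infinite matrix with
infinitely many distinct eigenvalues `ev k`. The `k`-th eigenvalue has geometric multiplicity
`gm k`, and its `i`-th Jordan block has size `size ⟨k, i⟩`. The columns of `U` are indexed by the
positions `⟨⟨k, i⟩, j⟩` of the direct sum, and `V` is the inverse of `U`. -/
structure JordanDecomposition (X : Matrix ℕ ℕ ℂ) where
  ev : ℕ → ℂ
  ev_injective : Function.Injective ev
  gm : ℕ → ℕ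
  gm_pos : ∀ k, 0 < gm k
  size : (Σ k : ℕ, Fin (gm k)) → ℕ
  size_pos : ∀ b, 0 < size b
  U : Matrix ℕ (Σ b : (Σ k : ℕ, Fin (gm k)), Fin (size b)) ℂ
  V : Matrix (Σ b : (Σ k : ℕ, Fin (gm k)), Fin (size b)) ℕ ℂ
  U_mul_V : IsMul U V 1
  V_mul_U : IsMul V U 1
  eq_conj : IsMul
    (mul U (Matrix.blockDiagonal' fun b : (Σ k : ℕ, Fin (gm k)) => jordanBlock (size b) (ev b.1)))
    V X

namespace JordanDecomposition

variable {X : Matrix ℕ ℕ ℂ} (D : JordanDecomposition X)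

/-- The index set of the Jordan blocks, i.e. the pairs `(k, i)` with `i` among the `gm k` blocks
of the `k`-th eigenvalue. -/
abbrev Block : Type := Σ k : ℕ, Fin (D.gm k)

/-- The index set of the Jordan basis. -/
abbrev Index : Type := Σ b : D.Block, Fin (D.size b)

/-- The Jordan matrix `⨁ₖ ⨁ᵢ J_{m k i}(ev k)`. -/
def J : Matrix D.Index D.Index ℂ :=
  Matrix.blockDiagonal' fun b => jordanBlock (D.size b) (D.ev b.1)

/-- The projector `P_{k,i} = U I_{k,i} U⁻¹`, where `I_{k,i}` is the identity on the block `(k, i)`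
and zero on all the other blocks. -/
def P (b : D.Block) : Matrix ℕ ℕ ℂ :=
  mul (mul D.U (Matrix.blockDiagonal' (Pi.single b 1))) D.V

/-- The nilpotent `N_{k,i} = U J'_{k,i} U⁻¹`, where `J'_{k,i}` is the nilpotent Jordan block on the
block `(k, i)` and zero on all the other blocks. -/
def N (b : D.Block) : Matrix ℕ ℕ ℂ :=
  mul (mul D.U (Matrix.blockDiagonal' (Pi.single b (jordanBlock (D.size b) 0)))) D.V

end JordanDecomposition

/-! Functions of several complex variables. -/

/-- The partial derivative with respect to the variable number `l`. -/
def partialDeriv {r : ℕ} (l : Fin r) (f : (Fin r → ℂ) → ℂ) : (Fin r → ℂ) → ℂ :=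
  fun z => deriv (fun w => f (Function.update z l w)) (z l)

/-- The mixed partial derivative of order `q l` in the variable number `l`, for all `l`. -/
def mixedDeriv {r : ℕ} (q : Fin r → ℕ) (f : (Fin r → ℂ) → ℂ) : (Fin r → ℂ) → ℂ :=
  (List.finRange r).foldr (fun l g => (partialDeriv l)^[q l] g) f

/-- The coefficient of `z₁ ^ n₁ ⋯ z_r ^ n_r` in the power series of `f` at the origin. -/
def powerCoeff {r : ℕ} (f : (Fin r → ℂ) → ℂ) (n : Fin r → ℕ) : ℂ :=
  mixedDeriv n f 0 / ∏ l, ((n l).factorial : ℂ)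

/-- `F = f(X₁, …, X_r)`: the power series `∑ a_{n₁…n_r} X₁ ^ n₁ ⋯ X_r ^ n_r` converges to `F`,
(unconditionally) in every entry. -/
def HasMatrixValue {r : ℕ} (f : (Fin r → ℂ) → ℂ) (X : Fin r → Matrix ℕ ℕ ℂ)
    (F : Matrix ℕ ℕ ℂ) : Prop :=
  HasSum (fun n : Fin r → ℕ => powerCoeff f n • prod fun l => pow (X l) (n l)) F

/-- Absolute convergence of the infinite matrix products and of the power series, the matrices
being written through their Jordan decompositions:
every entry of a product of the matrices `|U_l| (1 + |J_l|) |U_l⁻¹|` (with `l` nondecreasing from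
left to right) is finite, and so is every entry of
`∑ |a_{n₁…n_r}| ∏ |U_l| |J_l| ^ n_l |U_l⁻¹|`. -/
def AbsolutelyConvergent {r : ℕ} (f : (Fin r → ℂ) → ℂ) {X : Fin r → Matrix ℕ ℕ ℂ}
    (D : ∀ l, JordanDecomposition (X l)) : Prop :=
  (∀ (n : Fin r → ℕ) (a b : ℕ),
    prod (fun l => pow (mul (mul (abs (D l).U) (1 + abs (D l).J)) (abs (D l).V)) (n l)) a b ≠ ∞) ∧
  (∀ a b : ℕ,
    ∑' n : Fin r → ℕ, ‖powerCoeff f n‖ₑ *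
      prod (fun l => mul (mul (abs (D l).U) (pow (abs (D l).J) (n l))) (abs (D l).V)) a b ≠ ∞)

/-! The terms of the closed-form expression. Here `b l` is the pair `(k_l, i_l)`. -/

section Terms

variable {r : ℕ} (f : (Fin r → ℂ) → ℂ) {X : Fin r → Matrix ℕ ℕ ℂ}
  (D : ∀ l, JordanDecomposition (X l)) (b : ∀ l, (D l).Block)

/-- The tuple of eigenvalues `(λ_{k₁}, …, λ_{k_r})`. -/
def evTuple : Fin r → ℂ := fun l => (D l).ev (b l).1

/-- `f(λ_{k₁}, …, λ_{k_r}) P_{k₁,i₁} ⋯ P_{k_r,i_r}`. -/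
def projectorTerm : Matrix ℕ ℕ ℂ :=
  f (evTuple D b) • prod fun l => (D l).P (b l)

/-- For a set `S` of variables: the sum over all orders `1 ≤ q_l ≤ m_{k_l,i_l} - 1`, `l ∈ S`,
of `f^{(q)}(λ_{k₁}, …, λ_{k_r}) / ∏_{l ∈ S} q_l!` times the ordered product of the `Y_l`, where
`Y_l = N_{k_l,i_l} ^ q_l` for `l ∈ S` and `Y_l = P_{k_l,i_l}` for `l ∉ S`. -/
def selectionTerm (S : Finset (Fin r)) : Matrix ℕ ℕ ℂ :=
  ∑ q ∈ Fintype.piFinset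
      (fun l => if l ∈ S then Finset.Icc 1 ((D l).size (b l) - 1) else ({0} : Finset ℕ)),
    (mixedDeriv q f (evTuple D b) / ∏ l ∈ S, ((q l).factorial : ℂ)) •
      prod fun l => if l ∈ S then pow ((D l).N (b l)) (q l) else (D l).P (b l)

/-- The sum of the terms with nilpotents in `κ` of the variables, over `1 ≤ κ ≤ r - 1` and all
selections of `κ` variables. -/
def mixedTerm : Matrix ℕ ℕ ℂ :=
  ∑ κ ∈ Finset.Icc 1 (r - 1), ∑ S ∈ Finset.powersetCard κ (Finset.univ : Finset (Fin r)),
    selectionTerm f D b S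

/-- The sum over all `1 ≤ q_l ≤ m_{k_l,i_l} - 1` of
`f^{(q₁,…,q_r)}(λ_{k₁}, …, λ_{k_r}) / (q₁! ⋯ q_r!) N_{k₁,i₁} ^ q₁ ⋯ N_{k_r,i_r} ^ q_r`. -/
def nilpotentTerm : Matrix ℕ ℕ ℂ :=
  ∑ q ∈ Fintype.piFinset (fun l => Finset.Icc 1 ((D l).size (b l) - 1)),
    (mixedDeriv q f (evTuple D b) / ∏ l, ((q l).factorial : ℂ)) •
      prod fun l => pow ((D l).N (b l)) (q l)

end Terms

end

end InfMat

/-!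
The theorem is Fubini's theorem for one absolutely convergent double series.

Write `J_l` as the direct sum of the blocks `λ + N`, with `N` nilpotent. By the binomial theorem,
`X_l ^ n = U J ^ n U⁻¹` is the sum, over the blocks `b` and over `q < size b`, of the number
`coeff n ⟨b, q⟩ = (n choose q) λ_b ^ (n - q)` times a matrix `component ⟨b, q⟩`, which is `P_b` for
`q = 0` and `N_b ^ q` for `q ≥ 1`. The pairs `⟨b, q⟩` are just the positions of the Jordan basis.
Hence `f (X₁, …, X_r)` is the sum over `n` and over the tuples `β` of positions of
`a_n ∏ coeff (n l) (β l)` times the ordered product of the `component (β l)`.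
The same computation in `[0, ∞]` identifies the sum of `∏ |coeff (n l) (β l)|` times the ordered
product of the `absComponent (β l)` with the entry of `∏ |U| |J| ^ n |U⁻¹|`
(`prod_mul_pow_abs_J_mul`), so absolute convergence says that the double series over `(n, β)`
converges absolutely. Summation over `n` first gives the Taylor coefficient of `f` of order `q` at
the eigenvalues (`hasSum_taylor_mixedDeriv`), whence the closed form; the three sums in it, and in
fact the sum for every choice `S` of the variables with `q l ≠ 0`, are subfamilies of an absolutely
convergent series (`AbsolutelyConvergent.summable_selectionTerm`).

That `X ^ n = U J ^ n U⁻¹` needs the associativity of products of infinite matrices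
(`JordanDecomposition.pow_eq`). It holds whenever the product of the absolute values is finite, and
all the products that occur are dominated by powers of `|U| (1 + |J|) |U⁻¹|` because
`1 ≤ |U⁻¹| |U|`.

The Taylor expansion on a polydisc is proved by induction on the number of variables from the
expansion in one variable and from Cauchy's estimates.

In the column-finite or row-finite case, only finitely many tuples `β` contribute to a given entry,
and for each of them the sum over `n` converges absolutely by the Taylor expansion again
(`FinitenessClass.absolutelyConvergent`).
-/

namespace InfMat

open Function Topology

theorem hasSum_congr_fun {ι α : Type*} [AddCommMonoid α] [TopologicalSpace α] {f g : ι → α} {a : α}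
    (h : HasSum f a) (e : ∀ i, f i = g i) : HasSum g a :=
  funext e ▸ h

/-! ### Partial derivatives of analytic functions on a polydisc -/

/-- The open polydisc of polyradius `R ∈ [0, ∞]ʳ` around the origin. -/
def polydisc {r : ℕ} (R : Fin r → ℝ≥0∞) : Set (Fin r → ℂ) := {z | ∀ l, ‖z l‖ₑ < R l}

section Polydisc

variable {r : ℕ} {R : Fin r → ℝ≥0∞} {f g : (Fin r → ℂ) → ℂ} {z : Fin r → ℂ}

theorem isOpen_polydisc : IsOpen (polydisc R) := by
  have : polydisc R = ⋂ l, {z | ‖z l‖ₑ < R l} := by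
    ext z
    simp [polydisc]
  rw [this]
  exact isOpen_iInter_of_finite fun l =>
    isOpen_lt (continuous_enorm.comp (continuous_apply l)) continuous_const

theorem update_mem_polydisc (hz : z ∈ polydisc R) {l : Fin r} {w : ℂ} (hw : ‖w‖ₑ < R l) :
    update z l w ∈ polydisc R := by
  intro i
  rcases eq_or_ne i l with rfl | h
  · simpa using hw
  · simpa [h] using hz i

theorem partialDeriv_eq_fderiv (hf : DifferentiableAt ℂ f z) (l : Fin r) :
    partialDeriv l f z = fderiv ℂ f z (Pi.single l 1) := by
  have h1 : HasFDerivAt f (fderiv ℂ f z) (update z l (z l)) := by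
    simpa using hf.hasFDerivAt
  have := h1.comp_hasDerivAt (z l) (hasDerivAt_update z l (z l))
  exact this.deriv

theorem analyticOnNhd_partialDeriv (hf : AnalyticOnNhd ℂ f (polydisc R)) (l : Fin r) :
    AnalyticOnNhd ℂ (partialDeriv l f) (polydisc R) := by
  have h := (ContinuousLinearMap.apply ℂ ℂ (Pi.single l 1 : Fin r → ℂ)).comp_analyticOnNhd hf.fderiv
  refine h.congr isOpen_polydisc fun z hz => ?_
  exact (partialDeriv_eq_fderiv (hf z hz).differentiableAt l).symm

theorem eqOn_partialDeriv (h : Set.EqOn f g (polydisc R)) (l : Fin r) :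
    Set.EqOn (partialDeriv l f) (partialDeriv l g) (polydisc R) := by
  intro z hz
  refine Filter.EventuallyEq.deriv_eq ?_
  have hc : Continuous fun w => update z l w := continuous_const.update l continuous_id
  have : ∀ᶠ w in 𝓝 (z l), update z l w ∈ polydisc R :=
    hc.continuousAt.eventually (by simpa using isOpen_polydisc.mem_nhds hz)
  exact this.mono fun w hw => h hw

/-- Symmetry of the second derivative. -/
theorem partialDeriv_comm (hf : AnalyticOnNhd ℂ f (polydisc R)) (l m : Fin r) :
    Set.EqOn (partialDeriv l (partialDeriv m f)) (partialDeriv m (partialDeriv l f))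
      (polydisc R) := by
  have key : ∀ l m : Fin r, ∀ z ∈ polydisc R, partialDeriv l (partialDeriv m f) z =
      fderiv ℂ (fderiv ℂ f) z (Pi.single l 1) (Pi.single m 1) := by
    intro l m z hz
    have h1 : Set.EqOn (partialDeriv m f) (fun z => fderiv ℂ f z (Pi.single m 1)) (polydisc R) :=
      fun z hz => partialDeriv_eq_fderiv (hf z hz).differentiableAt m
    have h2 : DifferentiableAt ℂ (fderiv ℂ f) z := (hf.fderiv z hz).differentiableAt
    rw [eqOn_partialDeriv h1 l hz, partialDeriv_eq_fderiv (by fun_prop)]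
    rw [fderiv_clm_apply h2 (by fun_prop)]
    simp
  intro z hz
  rw [key l m z hz, key m l z hz]
  exact ((hf z hz).contDiffAt (n := ⊤)).isSymmSndFDerivAt_of_omega.eq _ _

theorem analyticOnNhd_iterate_partialDeriv (hf : AnalyticOnNhd ℂ f (polydisc R)) (l : Fin r)
    (k : ℕ) : AnalyticOnNhd ℂ ((partialDeriv l)^[k] f) (polydisc R) := by
  induction k with
  | zero => exact hf
  | succ k ih =>
    rw [iterate_succ_apply']
    exact analyticOnNhd_partialDeriv ih l

theorem eqOn_iterate_partialDeriv (h : Set.EqOn f g (polydisc R)) (l : Fin r) (k : ℕ) :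
    Set.EqOn ((partialDeriv l)^[k] f) ((partialDeriv l)^[k] g) (polydisc R) := by
  induction k with
  | zero => exact h
  | succ k ih =>
    rw [iterate_succ_apply', iterate_succ_apply']
    exact eqOn_partialDeriv ih l

theorem partialDeriv_iterate_comm (hf : AnalyticOnNhd ℂ f (polydisc R)) (l m : Fin r) (k : ℕ) :
    Set.EqOn (partialDeriv l ((partialDeriv m)^[k] f)) ((partialDeriv m)^[k] (partialDeriv l f))
      (polydisc R) := by
  induction k with
  | zero => exact fun _ _ => rfl
  | succ k ih =>
    rw [iterate_succ_apply', iterate_succ_apply']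
    exact (partialDeriv_comm (analyticOnNhd_iterate_partialDeriv hf m k) l m).trans
      (eqOn_partialDeriv ih m)

theorem iterate_partialDeriv_comm (hf : AnalyticOnNhd ℂ f (polydisc R)) (l m : Fin r) (j k : ℕ) :
    Set.EqOn ((partialDeriv l)^[j] ((partialDeriv m)^[k] f))
      ((partialDeriv m)^[k] ((partialDeriv l)^[j] f)) (polydisc R) := by
  induction j generalizing f with
  | zero => exact fun _ _ => rfl
  | succ j ih =>
    rw [iterate_succ_apply, iterate_succ_apply]
    exact (eqOn_iterate_partialDeriv (partialDeriv_iterate_comm hf l m k) l j).trans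
      (ih (analyticOnNhd_partialDeriv hf l))

theorem analyticOnNhd_foldr (hf : AnalyticOnNhd ℂ f (polydisc R)) (n : Fin r → ℕ)
    (L : List (Fin r)) :
    AnalyticOnNhd ℂ (L.foldr (fun l g => (partialDeriv l)^[n l] g) f) (polydisc R) := by
  induction L with
  | nil => exact hf
  | cons l L ih => exact analyticOnNhd_iterate_partialDeriv ih l (n l)

theorem iterate_partialDeriv_foldr_comm (hf : AnalyticOnNhd ℂ f (polydisc R)) (n : Fin r → ℕ)
    (L : List (Fin r)) (m : Fin r) (k : ℕ) :
    Set.EqOn (L.foldr (fun l g => (partialDeriv l)^[n l] g) ((partialDeriv m)^[k] f))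
      ((partialDeriv m)^[k] (L.foldr (fun l g => (partialDeriv l)^[n l] g) f)) (polydisc R) := by
  induction L with
  | nil => exact fun _ _ => rfl
  | cons l L ih =>
    exact (eqOn_iterate_partialDeriv ih l (n l)).trans
      (iterate_partialDeriv_comm (analyticOnNhd_foldr hf n L) l m (n l) k)

theorem mixedDeriv_mixedDeriv (hf : AnalyticOnNhd ℂ f (polydisc R)) (m q : Fin r → ℕ) :
    Set.EqOn (mixedDeriv m (mixedDeriv q f)) (mixedDeriv (m + q) f) (polydisc R) := by
  unfold mixedDeriv
  induction List.finRange r with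
  | nil => exact fun _ _ => rfl
  | cons l L ih =>
    rw [List.foldr_cons, List.foldr_cons, List.foldr_cons, Pi.add_apply, iterate_add_apply]
    refine eqOn_iterate_partialDeriv ?_ l (m l)
    exact (iterate_partialDeriv_foldr_comm (analyticOnNhd_foldr hf q L) m L l (q l)).trans
      (eqOn_iterate_partialDeriv ih l (q l))

/-! ### The Taylor expansion on a polydisc -/

theorem iterate_partialDeriv_update (l : Fin r) (k : ℕ) (f : (Fin r → ℂ) → ℂ) (z : Fin r → ℂ)
    (w : ℂ) :
    (partialDeriv l)^[k] f (update z l w) = iteratedDeriv k (fun w => f (update z l w)) w := by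
  induction k generalizing w with
  | zero => simp
  | succ k ih =>
    rw [iterate_succ_apply', iteratedDeriv_succ, ← funext ih]
    simp [partialDeriv]

theorem differentiableOn_update (hf : AnalyticOnNhd ℂ f (polydisc R)) (hz : z ∈ polydisc R)
    (l : Fin r) :
    DifferentiableOn ℂ (fun w => f (update z l w)) {w | ‖w‖ₑ < R l} := by
  intro w hw
  have h1 : DifferentiableAt ℂ f (update z l w) :=
    (hf _ (update_mem_polydisc hz hw)).differentiableAt
  exact (h1.comp w (hasDerivAt_update z l w).differentiableAt).differentiableWithinAt

/-- The Taylor expansion in one of the variables. -/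
theorem hasSum_partialDeriv (hf : AnalyticOnNhd ℂ f (polydisc R)) (hz : z ∈ polydisc R)
    (l : Fin r) :
    HasSum (fun k => (partialDeriv l)^[k] f (update z l 0) / (k.factorial : ℂ) * z l ^ k)
      (f z) := by
  have h := Complex.hasSum_taylorSeries_on_eball (c := 0) (r := R l) (z := z l)
    (f := fun w => f (update z l w))
    ((differentiableOn_update hf hz l).mono fun w hw => by simpa using hw)
    (by simpa using hz l)
  simp only [update_eq_self] at h
  refine hasSum_congr_fun h fun k => ?_
  rw [iterate_partialDeriv_update, sub_zero, smul_eq_mul, smul_eq_mul]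
  ring

/-- Cauchy's estimate in one of the variables. -/
theorem norm_iterate_partialDeriv_le (hf : AnalyticOnNhd ℂ f (polydisc R))
    (hz : z ∈ polydisc R) (l : Fin r) {ρ M : ℝ} (hρ : 0 < ρ) (hρR : ENNReal.ofReal ρ < R l)
    (hM : ∀ w, ‖w‖ ≤ ρ → ‖f (update z l w)‖ ≤ M) (k : ℕ) :
    ‖(partialDeriv l)^[k] f (update z l 0)‖ ≤ k.factorial * M / ρ ^ k := by
  rw [iterate_partialDeriv_update]
  refine Complex.norm_iteratedDeriv_le_of_forall_mem_sphere_norm_le k hρ ?_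
    fun w hw => hM w (by simpa using (mem_sphere_zero_iff_norm.1 hw).le)
  refine DifferentiableOn.diffContOnCl_ball (U := {w | ‖w‖ₑ < R l})
    (differentiableOn_update hf hz l) fun w hw => ?_
  refine lt_of_le_of_lt ?_ hρR
  rw [← ofReal_norm]
  exact ENNReal.ofReal_le_ofReal (by simpa using hw)

end Polydisc

theorem enorm_le_ofReal_iff {w : ℂ} {ρ : ℝ} (hρ : 0 ≤ ρ) : ‖w‖ₑ ≤ ENNReal.ofReal ρ ↔ ‖w‖ ≤ ρ := by
  rw [← ofReal_norm, ENNReal.ofReal_le_ofReal_iff hρ]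

section Taylor

variable {r : ℕ}

theorem update_cons_zero {w w' : ℂ} {z : Fin r → ℂ} :
    update (Fin.cons w z : Fin (r + 1) → ℂ) 0 w' = Fin.cons w' z := by
  simp

theorem cons_mem_polydisc {R : Fin (r + 1) → ℝ≥0∞} {w : ℂ} {z : Fin r → ℂ} :
    (Fin.cons w z : Fin (r + 1) → ℂ) ∈ polydisc R ↔ ‖w‖ₑ < R 0 ∧ z ∈ polydisc (Fin.tail R) := by
  simp [polydisc, Fin.forall_fin_succ, Fin.tail]

theorem analyticOnNhd_cons {R : Fin (r + 1) → ℝ≥0∞} {f : (Fin (r + 1) → ℂ) → ℂ}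
    (hf : AnalyticOnNhd ℂ f (polydisc R)) {w : ℂ} (hw : ‖w‖ₑ < R 0) :
    AnalyticOnNhd ℂ (fun z : Fin r → ℂ => f (Fin.cons w z)) (polydisc (Fin.tail R)) := by
  intro z hz
  have h1 : AnalyticAt ℂ (fun z : Fin r → ℂ => (Fin.cons w z : Fin (r + 1) → ℂ)) z := by
    refine AnalyticAt.pi fun i => ?_
    refine Fin.cases ?_ (fun j => ?_) i
    · simpa only [Fin.cons_zero] using analyticAt_const
    · simp only [Fin.cons_succ]
      exact (ContinuousLinearMap.proj (R := ℂ) (φ := fun _ : Fin r => ℂ) j).analyticAt z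
  exact (hf _ (cons_mem_polydisc.2 ⟨hw, hz⟩)).comp h1

theorem iterate_partialDeriv_succ (l : Fin r) (k : ℕ) (f : (Fin (r + 1) → ℂ) → ℂ) (w : ℂ)
    (z : Fin r → ℂ) :
    (partialDeriv l.succ)^[k] f (Fin.cons w z) =
      (partialDeriv l)^[k] (fun z => f (Fin.cons w z)) z := by
  induction k generalizing z with
  | zero => rfl
  | succ k ih =>
    rw [iterate_succ_apply', iterate_succ_apply', ← funext ih]
    simp [partialDeriv, Fin.cons_update]

/-- The derivatives in all the variables but the first one. -/
noncomputable def tailDeriv (n : Fin r → ℕ) (f : (Fin (r + 1) → ℂ) → ℂ) : (Fin (r + 1) → ℂ) → ℂ :=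
  ((List.finRange r).map Fin.succ).foldr
    (fun l g => (partialDeriv l)^[(Fin.cons 0 n : Fin (r + 1) → ℕ) l] g) f

theorem analyticOnNhd_tailDeriv {R : Fin (r + 1) → ℝ≥0∞} {f : (Fin (r + 1) → ℂ) → ℂ}
    (hf : AnalyticOnNhd ℂ f (polydisc R)) (n : Fin r → ℕ) :
    AnalyticOnNhd ℂ (tailDeriv n f) (polydisc R) :=
  analyticOnNhd_foldr hf _ _

theorem mixedDeriv_cons (k : ℕ) (n : Fin r → ℕ) (f : (Fin (r + 1) → ℂ) → ℂ) :
    mixedDeriv (Fin.cons k n : Fin (r + 1) → ℕ) f = (partialDeriv 0)^[k] (tailDeriv n f) := by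
  simp [mixedDeriv, tailDeriv, List.finRange_succ, List.foldr_map]

theorem tailDeriv_cons (n : Fin r → ℕ) (f : (Fin (r + 1) → ℂ) → ℂ) (w : ℂ) (z : Fin r → ℂ) :
    tailDeriv n f (Fin.cons w z) = mixedDeriv n (fun z => f (Fin.cons w z)) z := by
  unfold tailDeriv mixedDeriv
  induction List.finRange r generalizing z with
  | nil => rfl
  | cons l L ih =>
    simp only [List.map_cons, List.foldr_cons, Fin.cons_succ]
    rw [iterate_partialDeriv_succ, funext ih]

theorem cons_zero_zero : (Fin.cons 0 0 : Fin (r + 1) → ℂ) = 0 := by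
  ext i
  refine Fin.cases ?_ (fun j => ?_) i <;> simp

/-- Cauchy's estimate on a polydisc. -/
theorem norm_mixedDeriv_zero_le {R : Fin r → ℝ≥0∞} {f : (Fin r → ℂ) → ℂ}
    (hf : AnalyticOnNhd ℂ f (polydisc R)) {ρ : Fin r → ℝ} {M : ℝ} (hρ : ∀ l, 0 < ρ l)
    (hρR : ∀ l, ENNReal.ofReal (ρ l) < R l) (hM : ∀ z, (∀ l, ‖z l‖ ≤ ρ l) → ‖f z‖ ≤ M)
    (n : Fin r → ℕ) :
    ‖mixedDeriv n f 0‖ ≤ (∏ l, ((n l).factorial : ℝ)) * M / ∏ l, ρ l ^ n l := by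
  induction r with
  | zero => simpa [mixedDeriv] using hM 0 (by simp)
  | succ r ih =>
    obtain ⟨k, n, rfl⟩ : ∃ k m, n = Fin.cons k m := ⟨n 0, Fin.tail n, by simp⟩
    have hR0 : (0 : Fin (r + 1) → ℂ) ∈ polydisc R := fun l => by
      simpa using zero_le.trans_lt (hρR l)
    have h1 : ∀ w : ℂ, ‖w‖ ≤ ρ 0 → ‖tailDeriv n f (update 0 0 w)‖ ≤
        (∏ l, ((n l).factorial : ℝ)) * M / ∏ l, ρ (Fin.succ l) ^ n l := by
      intro w hw
      rw [← cons_zero_zero, update_cons_zero, tailDeriv_cons]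
      refine ih (analyticOnNhd_cons hf ?_) (fun l => hρ l.succ) (fun l => hρR l.succ)
        (fun z hz => hM _ ?_) n
      · exact ((enorm_le_ofReal_iff (hρ 0).le).2 hw).trans_lt (hρR 0)
      · exact Fin.cases (by simpa using hw) (by simpa using hz)
    have h2 := norm_iterate_partialDeriv_le (analyticOnNhd_tailDeriv hf n) hR0 0 (hρ 0) (hρR 0) h1 k
    have h0 : update (0 : Fin (r + 1) → ℂ) 0 0 = 0 := update_eq_self 0 _
    rw [h0] at h2
    rw [mixedDeriv_cons, Fin.prod_univ_succ, Fin.prod_univ_succ]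
    simp only [Fin.cons_zero, Fin.cons_succ]
    refine h2.trans (le_of_eq ?_)
    rw [← mul_div_assoc, div_div, mul_comm (∏ l, ρ (Fin.succ l) ^ n l)]
    ring_nf

theorem summable_prod_of_nonneg {g : Fin r → ℕ → ℝ} (h0 : ∀ l n, 0 ≤ g l n)
    (hg : ∀ l, Summable (g l)) : Summable fun n : Fin r → ℕ => ∏ l, g l (n l) := by
  induction r with
  | zero => exact (hasSum_fintype _).summable
  | succ r ih =>
    rw [← (Fin.consEquiv fun _ : Fin (r + 1) => ℕ).summable_iff]
    have := (hg 0).mul_of_nonneg (ih (fun l => h0 l.succ) fun l => hg l.succ) (fun n => h0 0 n)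
      (fun n => Finset.prod_nonneg fun l _ => h0 l.succ (n l))
    refine this.congr fun p => ?_
    simp [Fin.prod_univ_succ, Fin.consEquiv]

/-- The power series at the origin converges absolutely on the polydisc, by Cauchy's estimate on a
slightly larger closed polydisc than the one spanned by `z`. -/
theorem summable_taylor {R : Fin r → ℝ≥0∞} {f : (Fin r → ℂ) → ℂ}
    (hf : AnalyticOnNhd ℂ f (polydisc R)) {z : Fin r → ℂ} (hz : z ∈ polydisc R) :
    Summable fun n : Fin r → ℕ => powerCoeff f n * ∏ l, z l ^ n l := by
  have hρ : ∀ l, ∃ ρ : ℝ, ‖z l‖ < ρ ∧ ENNReal.ofReal ρ < R l := by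
    intro l
    obtain ⟨p, h1, h2⟩ := ENNReal.lt_iff_exists_nnreal_btwn.1 (hz l)
    refine ⟨p, ?_, by simpa using h2⟩
    rw [← ofReal_norm, ← ENNReal.ofReal_coe_nnreal] at h1
    exact (ENNReal.ofReal_lt_ofReal_iff_of_nonneg (norm_nonneg _)).1 h1
  choose ρ hzρ hρR using hρ
  have hρ0 : ∀ l, 0 < ρ l := fun l => (norm_nonneg _).trans_lt (hzρ l)
  have hK : IsCompact {z : Fin r → ℂ | ∀ l, ‖z l‖ ≤ ρ l} := by
    have := isCompact_univ_pi fun l => isCompact_closedBall (0 : ℂ) (ρ l)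
    convert this using 1
    ext z
    simp
  obtain ⟨M, hM⟩ := hK.exists_bound_of_continuousOn (f := f) fun z hz =>
    (hf z fun l => ((enorm_le_ofReal_iff (hρ0 l).le).2
      (hz l)).trans_lt (hρR l)).continuousAt.continuousWithinAt
  have hs := (summable_prod_of_nonneg (g := fun l n => (‖z l‖ / ρ l) ^ n)
    (fun l n => pow_nonneg (div_nonneg (norm_nonneg _) (hρ0 l).le) n)
    (fun l => summable_geometric_of_lt_one (div_nonneg (norm_nonneg _) (hρ0 l).le)
      ((div_lt_one (hρ0 l)).2 (hzρ l)))).mul_left M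
  refine Summable.of_norm_bounded hs fun n => ?_
  have h1 := norm_mixedDeriv_zero_le hf hρ0 hρR hM n
  have hfac : (0 : ℝ) < ∏ l, ((n l).factorial : ℝ) :=
    Finset.prod_pos fun l _ => by exact_mod_cast (n l).factorial_pos
  have hpos : 0 < ∏ l, ρ l ^ n l := Finset.prod_pos fun l _ => pow_pos (hρ0 l) _
  have h2 : ‖powerCoeff f n‖ ≤ M / ∏ l, ρ l ^ n l := by
    rw [powerCoeff, norm_div, norm_prod]
    simp only [Complex.norm_natCast]
    rw [div_le_iff₀ hfac]
    refine h1.trans (le_of_eq (by ring))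
  rw [norm_mul, norm_prod]
  simp only [norm_pow, div_pow]
  rw [Finset.prod_div_distrib, mul_div_assoc', mul_div_right_comm]
  exact mul_le_mul_of_nonneg_right h2 (Finset.prod_nonneg fun l _ => by positivity)

/-- Expansion in the variables `z 1, …, z r` for fixed `z 0`, and then of every coefficient in
`z 0`; the double series can be summed in this order as it converges absolutely. -/
theorem hasSum_taylor {R : Fin r → ℝ≥0∞} {f : (Fin r → ℂ) → ℂ}
    (hf : AnalyticOnNhd ℂ f (polydisc R)) {z : Fin r → ℂ} (hz : z ∈ polydisc R) :
    HasSum (fun n : Fin r → ℕ => powerCoeff f n * ∏ l, z l ^ n l) (f z) := by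
  induction r with
  | zero =>
    have := hasSum_unique fun n : Fin 0 → ℕ => powerCoeff f n * ∏ l, z l ^ n l
    convert this using 1
    simp [powerCoeff, mixedDeriv, Subsingleton.elim z 0]
  | succ r ih =>
    have hs := (summable_taylor hf hz).hasSum
    obtain ⟨w, z, rfl⟩ : ∃ w z', z = Fin.cons w z' := ⟨z 0, Fin.tail z, by simp⟩
    obtain ⟨hw, hz'⟩ := cons_mem_polydisc.1 hz
    have hw0 : (Fin.cons w 0 : Fin (r + 1) → ℂ) ∈ polydisc R :=
      cons_mem_polydisc.2 ⟨hw, fun l => by simpa using zero_le.trans_lt (hz' l)⟩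
    have h1 := ih (analyticOnNhd_cons hf hw) hz'
    have h2 := ((Equiv.prodComm _ _).trans (Fin.consEquiv fun _ : Fin (r + 1) => ℕ)).hasSum_iff.2 hs
    have h3 := h2.prod_fiberwise (g := fun n : Fin r → ℕ =>
      powerCoeff (fun z => f (Fin.cons w z)) n * ∏ l, z l ^ n l) fun n => by
      have := hasSum_partialDeriv (analyticOnNhd_tailDeriv hf n) hw0 0
      have h4 := this.mul_right ((∏ l, z l ^ n l) / ∏ l, ((n l).factorial : ℂ))
      have h5 : powerCoeff (fun z => f (Fin.cons w z)) n * ∏ l, z l ^ n l =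
          tailDeriv n f (Fin.cons w 0) * ((∏ l, z l ^ n l) / ∏ l, ((n l).factorial : ℂ)) := by
        rw [powerCoeff, tailDeriv_cons]
        ring
      rw [h5]
      refine hasSum_congr_fun h4 fun k => ?_
      simp only [comp_apply, Equiv.trans_apply, Equiv.prodComm_apply, Prod.swap_prod_mk,
        Fin.consEquiv, Equiv.coe_fn_mk, powerCoeff, mixedDeriv_cons, Fin.prod_univ_succ,
        Fin.cons_zero, Fin.cons_succ, update_cons_zero, cons_zero_zero]
      field_simp
    rwa [h1.unique h3]

/-- Termwise differentiation of the power series, obtained by expanding the derivative itself. -/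
theorem hasSum_taylor_mixedDeriv {R : Fin r → ℝ≥0∞} {f : (Fin r → ℂ) → ℂ}
    (hf : AnalyticOnNhd ℂ f (polydisc R)) {z : Fin r → ℂ} (hz : z ∈ polydisc R) (q : Fin r → ℕ) :
    HasSum (fun n : Fin r → ℕ => powerCoeff f n * ∏ l, ((n l).choose (q l) * z l ^ (n l - q l)))
      (mixedDeriv q f z / ∏ l, ((q l).factorial : ℂ)) := by
  have h := (hasSum_taylor (analyticOnNhd_foldr hf q (List.finRange r)) hz).div_const
    (∏ l, ((q l).factorial : ℂ))
  -- The terms with `n l < q l` for some `l` vanish; the others are indexed by `n - q`.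
  have hinj : Injective fun n : Fin r → ℕ => n + q := add_left_injective q
  refine (hinj.hasSum_iff ?_).1 ?_
  · intro n hn
    have : ∃ l, n l < q l := by
      by_contra! hle
      exact hn ⟨n - q, by ext l; simp [hle l]⟩
    obtain ⟨l, hl⟩ := this
    rw [Finset.prod_eq_zero (Finset.mem_univ l), mul_zero]
    simp [Nat.choose_eq_zero_of_lt hl]
  · refine hasSum_congr_fun h fun n => ?_
    have h0 : (0 : Fin r → ℂ) ∈ polydisc R := fun l => by
      simpa using zero_le.trans_lt (hz l)
    have h1 := mixedDeriv_mixedDeriv hf n q h0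
    have h2 : ∀ l, ((n l + q l).choose (q l) : ℂ) =
        ((n l + q l).factorial : ℂ) / ((n l).factorial * (q l).factorial) := fun l => by
      rw [← Nat.choose_symm_add, Nat.cast_add_choose]
    simp only [comp_apply, powerCoeff, Pi.add_apply, Nat.add_sub_cancel, Finset.prod_mul_distrib,
      h2, Finset.prod_div_distrib]
    rw [show List.foldr (fun l g => (partialDeriv l)^[q l] g) f (List.finRange r) =
      mixedDeriv q f from rfl, h1]
    have h3 : ∀ n : Fin r → ℕ, ∏ l, ((n l).factorial : ℂ) ≠ 0 := fun n =>
      Finset.prod_ne_zero_iff.2 fun l _ => by exact_mod_cast (n l).factorial_ne_zero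
    have h4 := h3 (n + q)
    have h5 := h3 n
    have h6 := h3 q
    simp only [Pi.add_apply] at h4
    field_simp

end Taylor

/-! ### The calculus of infinite matrices -/

theorem summable_of_tsum_enorm_ne_top {ι : Type*} {f : ι → ℂ} (h : ∑' i, ‖f i‖ₑ ≠ ∞) :
    Summable f := by
  refine Summable.of_nnnorm ?_
  exact ENNReal.tsum_coe_ne_top_iff_summable.1 h

theorem tsum_enorm_ne_top {ι : Type*} {f : ι → ℂ} (h : Summable f) : ∑' i, ‖f i‖ₑ ≠ ∞ :=
  ENNReal.tsum_coe_ne_top_iff_summable.2 (NNReal.summable_coe.1 (summable_norm_iff.2 h))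

section Calculus

variable {ι κ ν μ : Type*}

theorem mul_one {R : Type*} [Semiring R] [TopologicalSpace R] [DecidableEq κ]
    (A : Matrix ι κ R) : mul A 1 = A := by
  ext a b
  rw [mul, tsum_eq_single b fun c hc => by rw [Matrix.one_apply_ne hc, mul_zero]]
  simp

theorem one_mul {R : Type*} [Semiring R] [TopologicalSpace R] [DecidableEq ι]
    (A : Matrix ι κ R) : mul 1 A = A := by
  ext a b
  rw [mul, tsum_eq_single a fun c hc => by rw [Matrix.one_apply_ne hc.symm, zero_mul]]
  simp

theorem mul_assoc_ennreal (A : Matrix ι κ ℝ≥0∞) (B : Matrix κ ν ℝ≥0∞) (C : Matrix ν μ ℝ≥0∞) :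
    mul (mul A B) C = mul A (mul B C) := by
  ext a b
  simp only [mul, ← ENNReal.tsum_mul_left, ← ENNReal.tsum_mul_right]
  rw [ENNReal.tsum_comm]
  simp only [mul_assoc]

theorem mul_le_mul {A A' : Matrix ι κ ℝ≥0∞} {B B' : Matrix κ ν ℝ≥0∞} (hA : ∀ a b, A a b ≤ A' a b)
    (hB : ∀ a b, B a b ≤ B' a b) (a : ι) (b : ν) : mul A B a b ≤ mul A' B' a b :=
  ENNReal.tsum_le_tsum fun c => _root_.mul_le_mul' (hA a c) (hB c b)

theorem abs_mul_le (A : Matrix ι κ ℂ) (B : Matrix κ ν ℂ) (a : ι) (b : ν) :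
    abs (mul A B) a b ≤ mul (abs A) (abs B) a b := by
  refine (enorm_tsum_le_tsum_enorm (f := fun c => A a c * B c b)).trans (le_of_eq ?_)
  simp [mul, abs, enorm_mul]

/-- Associativity of the product, provided that all the double series converge absolutely. -/
theorem mul_assoc_of_ne_top {A : Matrix ι κ ℂ} {B : Matrix κ ν ℂ} {C : Matrix ν μ ℂ}
    (h : ∀ a b, mul (mul (abs A) (abs B)) (abs C) a b ≠ ∞) :
    mul (mul A B) C = mul A (mul B C) := by
  ext a b
  have hs : Summable fun p : ν × κ => A a p.2 * B p.2 p.1 * C p.1 b := by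
    refine summable_of_tsum_enorm_ne_top ?_
    rw [ENNReal.tsum_prod']
    convert h a b using 1
    simp [mul, abs, enorm_mul, ENNReal.tsum_mul_right]
  have hc := hs.tsum_comm (f := fun d c => A a c * B c d * C d b)
  simp only [mul, ← tsum_mul_left, ← tsum_mul_right]
  rw [← hc]
  simp only [mul_assoc]

theorem ne_top_of_mul_ne_top {A : Matrix ι κ ℝ≥0∞} {B : Matrix κ ν ℝ≥0∞} {a : ι} {b : ν} {c : κ}
    (h : mul A B a b ≠ ∞) (hA : A a c ≠ 0) : B c b ≠ ∞ := by
  intro hB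
  refine ENNReal.ne_top_of_tsum_ne_top h c ?_
  simp [hB, ENNReal.mul_top hA]

theorem ne_top_of_mul_ne_top' {A : Matrix ι κ ℝ≥0∞} {B : Matrix κ ν ℝ≥0∞} {a : ι} {b : ν} {c : κ}
    (h : mul A B a b ≠ ∞) (hB : B c b ≠ 0) : A a c ≠ ∞ := by
  intro hA
  refine ENNReal.ne_top_of_tsum_ne_top h c ?_
  simp [hA, ENNReal.top_mul hB]

end Calculus

section Prod

variable {R : Type*} [Semiring R] [TopologicalSpace R] {ι : Type*} [DecidableEq ι] {r : ℕ}

theorem prod_zero (A : Fin 0 → Matrix ι ι R) : prod A = 1 := by simp [prod]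

theorem prod_succ (A : Fin (r + 1) → Matrix ι ι R) :
    prod A = mul (A 0) (prod fun l => A l.succ) := by
  simp [prod, List.ofFn_succ]

theorem prod_le_prod {A B : Fin r → Matrix ι ι ℝ≥0∞} (h : ∀ l a b, A l a b ≤ B l a b) (a b : ι) :
    prod A a b ≤ prod B a b := by
  induction r generalizing a with
  | zero => simp [prod_zero]
  | succ r ih =>
    rw [prod_succ, prod_succ]
    exact mul_le_mul (h 0) (fun a b => ih (fun l => h l.succ) a) a b

theorem abs_prod_le (A : Fin r → Matrix ι ι ℂ) (a b : ι) :
    abs (prod A) a b ≤ prod (fun l => abs (A l)) a b := by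
  induction r generalizing a with
  | zero =>
    rw [prod_zero, prod_zero]
    by_cases h : a = b <;> simp [abs, Matrix.one_apply, h]
  | succ r ih =>
    rw [prod_succ, prod_succ]
    exact (abs_mul_le _ _ a b).trans (mul_le_mul (fun _ _ => le_rfl) (fun a b => ih _ a) a b)

theorem prod_smul_ennreal (c : Fin r → ℝ≥0∞) (A : Fin r → Matrix ι ι ℝ≥0∞) (a b : ι) :
    prod (fun l => c l • A l) a b = (∏ l, c l) * prod A a b := by
  induction r generalizing a with
  | zero => simp [prod_zero]
  | succ r ih =>
    rw [prod_succ, prod_succ, Fin.prod_univ_succ]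
    simp only [mul, ih, ← ENNReal.tsum_mul_left, Matrix.smul_apply, smul_eq_mul]
    exact tsum_congr fun d => by ring

theorem prod_smul (c : Fin r → ℂ) (A : Fin r → Matrix ι ι ℂ) (a b : ι) :
    prod (fun l => c l • A l) a b = (∏ l, c l) * prod A a b := by
  induction r generalizing a with
  | zero => simp [prod_zero]
  | succ r ih =>
    rw [prod_succ, prod_succ, Fin.prod_univ_succ]
    simp only [mul, ih, ← tsum_mul_left, Matrix.smul_apply, smul_eq_mul]
    exact tsum_congr fun d => by ring

/-- The entrywise sum of a family of matrices. -/
noncomputable def entrySum {R : Type*} [Semiring R] [TopologicalSpace R] {β κ ν : Type*}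
    (A : β → Matrix κ ν R) : Matrix κ ν R :=
  fun a b => ∑' x, A x a b

/-- Distributivity of the ordered product over sums, for entries in `[0, ∞]`. -/
theorem prod_tsum_ennreal {β : Fin r → Type*} (A : ∀ l, β l → Matrix ι ι ℝ≥0∞) (a b : ι) :
    prod (fun l => entrySum (A l)) a b =
      ∑' x : ∀ l, β l, prod (fun l => A l (x l)) a b := by
  induction r generalizing a with
  | zero => simp [prod_zero]
  | succ r ih =>
    rw [← (Fin.consEquiv β).tsum_eq, ENNReal.tsum_prod']
    simp only [prod_succ, Fin.consEquiv, Equiv.coe_fn_mk, Fin.cons_zero, Fin.cons_succ]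
    simp only [mul]
    have h1 : ∀ x, ∑' y : ∀ l : Fin r, β l.succ,
        ∑' c, A 0 x a c * prod (fun l => A l.succ (y l)) c b =
        ∑' c, A 0 x a c * ∑' y : ∀ l : Fin r, β l.succ, prod (fun l => A l.succ (y l)) c b := by
      intro x
      rw [ENNReal.tsum_comm]
      simp only [ENNReal.tsum_mul_left]
    simp only [h1]
    rw [ENNReal.tsum_comm]
    refine tsum_congr fun c => ?_
    rw [ENNReal.tsum_mul_right, ih (fun l => A l.succ) c]
    rfl

/-- Distributivity of the ordered product over absolutely convergent sums. -/
theorem hasSum_prod {β : Fin r → Type*} (A : ∀ l, β l → Matrix ι ι ℂ) (S : Fin r → Matrix ι ι ℂ)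
    (hS : ∀ l a b, HasSum (fun x => A l x a b) (S l a b)) (a b : ι)
    (h : prod (fun l => entrySum fun x => abs (A l x)) a b ≠ ∞) :
    HasSum (fun x : ∀ l, β l => prod (fun l => A l (x l)) a b) (prod S a b) := by
  have hs : ∀ {r : ℕ} {β : Fin r → Type _} (A : ∀ l, β l → Matrix ι ι ℂ) (a b : ι),
      prod (fun l => entrySum fun x => abs (A l x)) a b ≠ ∞ →
      Summable (fun x : ∀ l, β l => prod (fun l => A l (x l)) a b) := by
    intro r β A a b h
    rw [prod_tsum_ennreal] at h
    exact summable_of_tsum_enorm_ne_top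
      (ne_top_of_le_ne_top h (ENNReal.tsum_le_tsum fun x => abs_prod_le _ a b))
  rw [(hs A a b h).hasSum_iff]
  induction r generalizing a with
  | zero => simp [prod_zero]
  | succ r ih =>
    rw [← (Fin.consEquiv β).tsum_eq]
    simp only [prod_succ, Fin.consEquiv, Equiv.coe_fn_mk, Fin.cons_zero, Fin.cons_succ]
    rw [prod_succ] at h
    have hF : Summable fun p : (β 0 × ∀ l : Fin r, β l.succ) × ι =>
        A 0 p.1.1 a p.2 * prod (fun l => A l.succ (p.1.2 l)) p.2 b := by
      refine summable_of_tsum_enorm_ne_top (ne_top_of_le_ne_top h ?_)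
      rw [ENNReal.tsum_prod', ENNReal.tsum_comm]
      refine ENNReal.tsum_le_tsum fun c => ?_
      rw [ENNReal.tsum_prod', prod_tsum_ennreal, entrySum, ← ENNReal.tsum_mul_right]
      dsimp only
      refine ENNReal.tsum_le_tsum fun x => ?_
      rw [← ENNReal.tsum_mul_left]
      refine ENNReal.tsum_le_tsum fun y => ?_
      rw [enorm_mul]
      exact mul_le_mul_right (abs_prod_le _ c b) _
    have h1 := hF.tsum_comm (f := fun (p : β 0 × ∀ l : Fin r, β l.succ) c =>
      A 0 p.1 a c * prod (fun l => A l.succ (p.2 l)) c b)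
    simp only [mul]
    rw [← h1]
    refine tsum_congr fun c => ?_
    have hc : Summable fun p : β 0 × ∀ l : Fin r, β l.succ =>
        A 0 p.1 a c * prod (fun l => A l.succ (p.2 l)) c b :=
      hF.comp_injective (i := fun p => (p, c)) fun p q h => by simpa using h
    rw [hc.tsum_prod, ← (hS 0 a c).tsum_eq, ← tsum_mul_right]
    refine tsum_congr fun x => ?_
    dsimp only
    rw [tsum_mul_left]
    by_cases h0 : A 0 x a c = 0
    · simp [h0]
    · have hne : prod (fun l : Fin r => entrySum fun x => abs (A l.succ x)) c b ≠ ∞ := by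
        refine ne_top_of_mul_ne_top h (c := c) fun h2 => h0 ?_
        simpa [abs] using ENNReal.tsum_eq_zero.1 (show ∑' x, abs (A 0 x) a c = 0 from h2) x
      rw [ih (fun l => A l.succ) _ (fun l => hS l.succ) c hne]

end Prod

/-! ### Block diagonal matrices and Jordan blocks -/

section Blocks

variable {R : Type*} [CommSemiring R] {ι κ B : Type*} {s : B → ℕ}

/-- The part of the product `U M V` that stems from a single diagonal block `M`. -/
def sandwich (U : Matrix ι (Σ b, Fin (s b)) R) (V : Matrix (Σ b, Fin (s b)) κ R) (b : B)
    (M : Matrix (Fin (s b)) (Fin (s b)) R) : Matrix ι κ R :=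
  fun a c => ∑ j, (∑ i, U a ⟨b, i⟩ * M i j) * V ⟨b, j⟩ c

section BlockDiagonal

variable [TopologicalSpace R] [DecidableEq B]

theorem mul_blockDiagonal'_apply (A : Matrix ι (Σ b, Fin (s b)) R)
    (M : ∀ b, Matrix (Fin (s b)) (Fin (s b)) R) (a : ι) (b : B) (j : Fin (s b)) :
    mul A (Matrix.blockDiagonal' M) a ⟨b, j⟩ = ∑ i, A a ⟨b, i⟩ * M b i j := by
  have h : ∀ x : Σ b, Fin (s b),
      x ∉ (Finset.univ.map (Embedding.sigmaMk b) : Finset (Σ b, Fin (s b))) →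
      A a x * Matrix.blockDiagonal' M x ⟨b, j⟩ = 0 := by
    rintro ⟨b', i⟩ hx
    have : b' ≠ b := by
      rintro rfl
      exact hx (by simp)
    rw [Matrix.blockDiagonal'_apply_ne M i j this, MulZeroClass.mul_zero]
  rw [mul, tsum_eq_sum h, Finset.sum_map]
  simp [Matrix.blockDiagonal'_apply_eq]

theorem blockDiagonal'_mul_blockDiagonal' (M N : ∀ b, Matrix (Fin (s b)) (Fin (s b)) R) :
    mul (Matrix.blockDiagonal' M) (Matrix.blockDiagonal' N) =
      Matrix.blockDiagonal' fun b => M b * N b := by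
  ext ⟨b, i⟩ ⟨b', j⟩
  rw [mul_blockDiagonal'_apply]
  rcases eq_or_ne b b' with rfl | h
  · simp [Matrix.blockDiagonal'_apply_eq, Matrix.mul_apply]
  · rw [Matrix.blockDiagonal'_apply_ne _ _ _ h]
    exact Finset.sum_eq_zero fun k _ => by
      rw [Matrix.blockDiagonal'_apply_ne _ _ _ h, MulZeroClass.zero_mul]

theorem pow_blockDiagonal' (M : ∀ b, Matrix (Fin (s b)) (Fin (s b)) R) (n : ℕ) :
    pow (Matrix.blockDiagonal' M) n = Matrix.blockDiagonal' fun b => M b ^ n := by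
  induction n with
  | zero =>
    simp only [pow, pow_zero]
    exact Matrix.blockDiagonal'_one.symm
  | succ n ih => rw [pow, ih, blockDiagonal'_mul_blockDiagonal']; simp only [pow_succ]

theorem mul_mul_blockDiagonal'_single (U : Matrix ι (Σ b, Fin (s b)) R)
    (V : Matrix (Σ b, Fin (s b)) κ R) (b : B) (M : Matrix (Fin (s b)) (Fin (s b)) R) :
    mul (mul U (Matrix.blockDiagonal' (Pi.single b M))) V = sandwich U V b M := by
  ext a c
  have h : ∀ x : Σ b, Fin (s b),
      x ∉ (Finset.univ.map (Embedding.sigmaMk b) : Finset (Σ b, Fin (s b))) →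
      mul U (Matrix.blockDiagonal' (Pi.single b M)) a x * V x c = 0 := by
    rintro ⟨b', i⟩ hx
    have : b' ≠ b := by
      rintro rfl
      exact hx (by simp)
    rw [mul_blockDiagonal'_apply, Pi.single_eq_of_ne this]
    simp
  rw [mul, tsum_eq_sum h, Finset.sum_map]
  simp [sandwich, mul_blockDiagonal'_apply]

end BlockDiagonal

theorem sandwich_sum_smul (U : Matrix ι (Σ b, Fin (s b)) R) (V : Matrix (Σ b, Fin (s b)) κ R)
    (b : B) {ν : Type*} (t : Finset ν) (c : ν → R) (M : ν → Matrix (Fin (s b)) (Fin (s b)) R) :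
    sandwich U V b (∑ q ∈ t, c q • M q) = ∑ q ∈ t, c q • sandwich U V b (M q) := by
  ext a d
  simp only [sandwich, Matrix.sum_apply, Matrix.smul_apply, smul_eq_mul, Finset.mul_sum,
    Finset.sum_mul]
  refine Eq.symm (Finset.sum_comm.trans (Finset.sum_congr rfl fun j _ => Finset.sum_comm.trans
    (Finset.sum_congr rfl fun i _ => Finset.sum_congr rfl fun q _ => ?_)))
  ring

/-- The `q`-th power of the nilpotent Jordan block: ones on the `q`-th superdiagonal. -/
def shift (R : Type*) [CommSemiring R] (m q : ℕ) : Matrix (Fin m) (Fin m) R :=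
  fun i j => if (i : ℕ) + q = j then 1 else 0

theorem shift_zero (m : ℕ) : shift R m 0 = 1 := by
  ext i j
  simp [shift, Matrix.one_apply, Fin.ext_iff]

theorem shift_mul_shift (m p q : ℕ) : shift R m p * shift R m q = shift R m (p + q) := by
  ext i j
  rw [Matrix.mul_apply]
  by_cases h : (i : ℕ) + p < m
  · rw [Finset.sum_eq_single ⟨i + p, h⟩]
    · simp [shift, add_assoc]
    · intro k _ hk
      have : (i : ℕ) + p ≠ k := fun e => hk (Fin.ext e.symm)
      simp [shift, this]
    · simp
  · have h2 : (i : ℕ) + (p + q) ≠ j := by omega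
    simp only [shift, h2, if_false]
    refine Finset.sum_eq_zero fun k _ => ?_
    have : (i : ℕ) + p ≠ k := by omega
    simp [this]

theorem shift_one_pow (m q : ℕ) : shift R m 1 ^ q = shift R m q := by
  induction q with
  | zero => rw [pow_zero, shift_zero]
  | succ q ih => rw [pow_succ, ih, shift_mul_shift]

theorem shift_eq_zero {m q : ℕ} (h : m ≤ q) : shift R m q = 0 := by
  ext i j
  have : (i : ℕ) + q ≠ j := by omega
  simp [shift, this]

/-- The powers of a Jordan block, by the binomial theorem. -/
theorem smul_one_add_shift_pow (m : ℕ) (c : R) (n : ℕ) :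
    (c • 1 + shift R m 1) ^ n =
      ∑ q : Fin m, (n.choose q * c ^ (n - q)) • shift R m (q : ℕ) := by
  have h : Commute (shift R m 1) (c • 1) := by
    simp [Commute, SemiconjBy]
  rw [add_comm, h.add_pow, Fin.sum_univ_eq_sum_range
    (fun q => (n.choose q * c ^ (n - q)) • shift R m q) m]
  have e : ∀ q, shift R m 1 ^ q * (c • (1 : Matrix (Fin m) (Fin m) R)) ^ (n - q) *
      (n.choose q : ℕ) = (n.choose q * c ^ (n - q)) • shift R m q := by
    intro q
    rw [shift_one_pow, smul_pow, one_pow, ← nsmul_eq_mul', mul_smul_comm, _root_.mul_one,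
      ← Nat.cast_smul_eq_nsmul R, smul_smul]
  simp only [e]
  -- Beyond `n` the binomial coefficients vanish, beyond `m - 1` the powers of the nilpotent block.
  have h1 : ∑ q ∈ Finset.range (n + 1), (n.choose q * c ^ (n - q)) • shift R m q =
      ∑ q ∈ Finset.range (max (n + 1) m), (n.choose q * c ^ (n - q)) • shift R m q := by
    refine Finset.sum_subset (Finset.range_subset_range.2 (by omega)) fun q _ hq => ?_
    rw [Nat.choose_eq_zero_of_lt (by simpa using hq)]
    simp
  have h2 : ∑ q ∈ Finset.range m, (n.choose q * c ^ (n - q)) • shift R m q =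
      ∑ q ∈ Finset.range (max (n + 1) m), (n.choose q * c ^ (n - q)) • shift R m q := by
    refine Finset.sum_subset (Finset.range_subset_range.2 (by omega)) fun q _ hq => ?_
    rw [shift_eq_zero (by simpa using hq), smul_zero]
  rw [h1, h2]

theorem jordanBlock_eq (m : ℕ) (c : ℂ) : jordanBlock m c = c • 1 + shift ℂ m 1 := by
  ext i j
  by_cases h : i = j
  · simp [jordanBlock, shift, h]
  · simp [jordanBlock, shift, h]

theorem enorm_jordanBlock (m : ℕ) (c : ℂ) (i j : Fin m) :
    ‖jordanBlock m c i j‖ₑ = (‖c‖ₑ • 1 + shift ℝ≥0∞ m 1 : Matrix (Fin m) (Fin m) ℝ≥0∞) i j := by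
  by_cases h : i = j
  · simp [jordanBlock, shift, h]
  · by_cases h2 : (i : ℕ) + 1 = j <;> simp [jordanBlock, shift, h, h2]

theorem enorm_shift (m q : ℕ) (i j : Fin m) : ‖shift ℂ m q i j‖ₑ = shift ℝ≥0∞ m q i j := by
  by_cases h2 : (i : ℕ) + q = j <;> simp [shift, h2]

theorem enorm_sandwich_le (U : Matrix ι (Σ b, Fin (s b)) ℂ) (V : Matrix (Σ b, Fin (s b)) κ ℂ)
    (b : B) (q : ℕ) (a : ι) (c : κ) :
    ‖sandwich U V b (shift ℂ (s b) q) a c‖ₑ ≤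
      sandwich (abs U) (abs V) b (shift ℝ≥0∞ (s b) q) a c := by
  refine (enorm_sum_le _ _).trans (Finset.sum_le_sum fun j _ => ?_)
  rw [enorm_mul]
  refine mul_le_mul_left ((enorm_sum_le _ _).trans (Finset.sum_le_sum fun i _ => ?_)) _
  rw [enorm_mul, enorm_shift]
  rfl

/-- Multiplicativity of `M ↦ U M V` on a block, for `V U = 1`. -/
theorem sandwich_mul_sandwich [DecidableEq B] {U : Matrix ι (Σ b, Fin (s b)) ℂ}
    {V : Matrix (Σ b, Fin (s b)) ι ℂ} (h : IsMul V U 1) (b : B)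
    (M N : Matrix (Fin (s b)) (Fin (s b)) ℂ) :
    mul (sandwich U V b M) (sandwich U V b N) = sandwich U V b (M * N) := by
  ext a d
  have h1 : HasSum (fun c => ∑ j, ∑ j', (∑ i, U a ⟨b, i⟩ * M i j) *
      (∑ i', V ⟨b, j⟩ c * U c ⟨b, i'⟩ * N i' j') * V ⟨b, j'⟩ d)
      (∑ j, ∑ j', (∑ i, U a ⟨b, i⟩ * M i j) *
      (∑ i', (1 : Matrix (Σ b, Fin (s b)) (Σ b, Fin (s b)) ℂ) ⟨b, j⟩ ⟨b, i'⟩ * N i' j') *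
        V ⟨b, j'⟩ d) :=
    hasSum_sum fun j _ => hasSum_sum fun j' _ =>
      ((hasSum_sum fun i' _ => (h ⟨b, j⟩ ⟨b, i'⟩).mul_right _).mul_left _).mul_right _
  have h2 := h1.tsum_eq
  rw [mul]
  convert h2 using 1
  · refine tsum_congr fun c => ?_
    rw [sandwich, sandwich, Finset.sum_mul_sum]
    refine Finset.sum_congr rfl fun j _ => Finset.sum_congr rfl fun j' _ => ?_
    have e : ∑ i', V ⟨b, j⟩ c * U c ⟨b, i'⟩ * N i' j' =
        V ⟨b, j⟩ c * ∑ i', U c ⟨b, i'⟩ * N i' j' := by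
      rw [Finset.mul_sum]
      exact Finset.sum_congr rfl fun i' _ => mul_assoc _ _ _
    rw [e]
    ring
  · rw [sandwich, Finset.sum_comm]
    refine Finset.sum_congr rfl fun j' _ => ?_
    have e : ∀ j, ∑ i', (1 : Matrix (Σ b, Fin (s b)) (Σ b, Fin (s b)) ℂ) ⟨b, j⟩ ⟨b, i'⟩ * N i' j' =
        N j j' := fun j => by
      rw [Finset.sum_eq_single j]
      · simp
      · intro i' _ hi'
        rw [Matrix.one_apply_ne (by simpa using hi'.symm), MulZeroClass.zero_mul]
      · simp
    simp only [e, Matrix.mul_apply, ← Finset.sum_mul]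
    congr 1
    simp only [Finset.mul_sum, Finset.sum_mul]
    exact Finset.sum_comm.trans (Finset.sum_congr rfl fun j _ => Finset.sum_congr rfl fun i _ =>
      (mul_assoc _ _ _).symm)

end Blocks

/-! ### Powers of a matrix with a Jordan decomposition -/

namespace JordanDecomposition

variable {X : Matrix ℕ ℕ ℂ} (D : JordanDecomposition X)

/-- The matrix `U J' ^ q U⁻¹`, where `J'` is the nilpotent Jordan block on the block `b`, for
`⟨b, q⟩` in the index set of the Jordan basis: it is `P b` for `q = 0` and `N b ^ q` for `q ≥ 1`. -/
def component (β : D.Index) : Matrix ℕ ℕ ℂ :=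
  sandwich D.U D.V β.1 (shift ℂ (D.size β.1) β.2)

/-- The analogue of `component` for `|U|` and `|U⁻¹|`. -/
noncomputable def absComponent (β : D.Index) : Matrix ℕ ℕ ℝ≥0∞ :=
  sandwich (abs D.U) (abs D.V) β.1 (shift ℝ≥0∞ (D.size β.1) β.2)

/-- The coefficient `(n choose q) ev ^ (n - q)` of `component ⟨b, q⟩` in `X ^ n`. -/
def coeff (n : ℕ) (β : D.Index) : ℂ := n.choose β.2 * D.ev β.1.1 ^ (n - β.2)

theorem enorm_coeff (n : ℕ) (β : D.Index) :
    ‖D.coeff n β‖ₑ = n.choose β.2 * ‖D.ev β.1.1‖ₑ ^ (n - β.2) := by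
  rw [coeff, enorm_mul, enorm_pow, ← ofReal_norm (n.choose β.2 : ℂ), Complex.norm_natCast,
    ENNReal.ofReal_natCast]

theorem abs_component_le (β : D.Index) (a c : ℕ) :
    abs (D.component β) a c ≤ D.absComponent β a c :=
  enorm_sandwich_le _ _ _ _ _ _

theorem abs_coeff_smul_component_le (n : ℕ) (β : D.Index) (a c : ℕ) :
    abs (D.coeff n β • D.component β) a c ≤ (‖D.coeff n β‖ₑ • D.absComponent β) a c := by
  rw [abs, Matrix.map_apply, Matrix.smul_apply, Matrix.smul_apply, smul_eq_mul, smul_eq_mul,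
    enorm_mul]
  gcongr
  exact D.abs_component_le β a c

theorem P_eq (b : D.Block) : D.P b = sandwich D.U D.V b (shift ℂ (D.size b) 0) := by
  rw [P, mul_mul_blockDiagonal'_single, shift_zero]

theorem N_eq (b : D.Block) : D.N b = sandwich D.U D.V b (shift ℂ (D.size b) 1) := by
  rw [N, mul_mul_blockDiagonal'_single, jordanBlock_eq, zero_smul, zero_add]

theorem pow_N (b : D.Block) {q : ℕ} (hq : 1 ≤ q) :
    pow (D.N b) q = sandwich D.U D.V b (shift ℂ (D.size b) q) := by
  induction q, hq using Nat.le_induction with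
  | base => rw [pow, pow, one_mul, N_eq]
  | succ q _ ih => rw [pow, ih, N_eq, sandwich_mul_sandwich D.V_mul_U, shift_mul_shift]

theorem J_eq : D.J = Matrix.blockDiagonal' fun b : D.Block =>
    D.ev b.1 • 1 + shift ℂ (D.size b) 1 := by
  simp only [J, jordanBlock_eq]

theorem abs_J_eq : abs D.J = Matrix.blockDiagonal' fun b : D.Block =>
    ‖D.ev b.1‖ₑ • 1 + shift ℝ≥0∞ (D.size b) 1 := by
  ext ⟨b, i⟩ ⟨b', j⟩
  rcases eq_or_ne b b' with rfl | h
  · rw [Matrix.blockDiagonal'_apply_eq, ← enorm_jordanBlock, abs, Matrix.map_apply, J,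
      Matrix.blockDiagonal'_apply_eq]
  · rw [Matrix.blockDiagonal'_apply_ne _ _ _ h, abs, Matrix.map_apply, J,
      Matrix.blockDiagonal'_apply_ne _ _ _ h, enorm_zero]

theorem abs_pow_J_le (n : ℕ) (x y : D.Index) : abs (pow D.J n) x y ≤ pow (abs D.J) n x y := by
  induction n generalizing y with
  | zero => by_cases h : x = y <;> simp [pow, abs, Matrix.one_apply, h]
  | succ n ih =>
    exact (abs_mul_le _ _ x y).trans (ENNReal.tsum_le_tsum fun z => by gcongr; exact ih z)

/-- `|U| |J| ^ n |U⁻¹|` as a combination of the matrices `absComponent`. -/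
theorem mul_pow_abs_J_mul (n : ℕ) :
    mul (mul (abs D.U) (pow (abs D.J) n)) (abs D.V) =
      entrySum fun β : D.Index => ‖D.coeff n β‖ₑ • D.absComponent β := by
  ext a c
  unfold entrySum
  rw [mul]
  refine (ENNReal.tsum_sigma' _).trans (Eq.trans ?_ (ENNReal.tsum_sigma' _).symm)
  refine tsum_congr fun b => ?_
  rw [tsum_fintype, tsum_fintype, abs_J_eq, pow_blockDiagonal']
  simp only [mul_blockDiagonal'_apply, smul_one_add_shift_pow]
  have h := congrFun (congrFun (sandwich_sum_smul (abs D.U) (abs D.V) b Finset.univ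
    (fun q : Fin (D.size b) => (n.choose q * ‖D.ev b.1‖ₑ ^ (n - q) : ℝ≥0∞))
    fun q => shift ℝ≥0∞ (D.size b) q) a) c
  refine Eq.trans h ?_
  rw [Matrix.sum_apply]
  simp only [enorm_coeff]
  rfl

/-- Under absolute convergence, `U J ^ n U⁻¹` is a combination of the matrices `component`. -/
theorem hasSum_coeff_smul_component {n : ℕ} {a c : ℕ}
    (h : mul (mul (abs D.U) (pow (abs D.J) n)) (abs D.V) a c ≠ ∞) :
    HasSum (fun β : D.Index => (D.coeff n β • D.component β) a c)
      (mul (mul D.U (pow D.J n)) D.V a c) := by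
  have hs : Summable fun β : D.Index => (D.coeff n β • D.component β) a c := by
    refine summable_of_tsum_enorm_ne_top (ne_top_of_le_ne_top h ?_)
    rw [mul_pow_abs_J_mul]
    exact ENNReal.tsum_le_tsum fun β => D.abs_coeff_smul_component_le n β a c
  have hs' : Summable fun x : D.Index => mul D.U (pow D.J n) a x * D.V x c := by
    refine summable_of_tsum_enorm_ne_top (ne_top_of_le_ne_top h ?_)
    refine ENNReal.tsum_le_tsum fun x => ?_
    rw [enorm_mul]
    refine mul_le_mul_left ((abs_mul_le _ _ a x).trans ?_) _
    exact mul_le_mul (fun _ _ => le_rfl) (D.abs_pow_J_le n) a x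
  rw [hs.hasSum_iff, mul, hs.tsum_sigma, hs'.tsum_sigma]
  refine tsum_congr fun b => ?_
  rw [tsum_fintype, tsum_fintype, J_eq, pow_blockDiagonal']
  simp only [mul_blockDiagonal'_apply, smul_one_add_shift_pow]
  have h := congrFun (congrFun (sandwich_sum_smul D.U D.V b Finset.univ
    (fun q : Fin (D.size b) => (n.choose q * D.ev b.1 ^ (n - q) : ℂ))
    fun q => shift ℂ (D.size b) q) a) c
  refine Eq.trans ?_ h.symm
  rw [Matrix.sum_apply]
  rfl

theorem exists_abs_V_ne_zero (x : D.Index) : ∃ c, abs D.V x c ≠ 0 := by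
  by_contra! h
  have h1 := (D.V_mul_U x x).tsum_eq
  have h2 : ∀ c, D.V x c = 0 := fun c => by simpa [abs] using h c
  simp [h2] at h1

theorem one_le_abs_V_mul_abs_U (x y : D.Index) :
    (1 : Matrix D.Index D.Index ℝ≥0∞) x y ≤ mul (abs D.V) (abs D.U) x y := by
  have h1 : mul D.V D.U x y = (1 : Matrix D.Index D.Index ℂ) x y := (D.V_mul_U x y).tsum_eq
  refine le_trans (le_of_eq ?_) (abs_mul_le _ _ x y)
  rw [abs, Matrix.map_apply, h1]
  by_cases h : x = y <;> simp [Matrix.one_apply, h]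

/-- The matrix `|U| (1 + |J|) |U⁻¹|`. -/
noncomputable def majorant : Matrix ℕ ℕ ℝ≥0∞ := mul (mul (abs D.U) (1 + abs D.J)) (abs D.V)

theorem abs_U_mul_abs_V_le (a c : ℕ) : mul (abs D.U) (abs D.V) a c ≤ D.majorant a c := by
  refine mul_le_mul (fun a x => ?_) (fun _ _ => le_rfl) a c
  have h := mul_le_mul (A := abs D.U) (A' := abs D.U) (B := 1) (B' := 1 + abs D.J)
    (fun _ _ => le_rfl) (fun x y => by simp) a x
  rwa [mul_one] at h

theorem abs_U_mul_abs_J_mul_abs_V_le (a c : ℕ) :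
    mul (mul (abs D.U) (abs D.J)) (abs D.V) a c ≤ D.majorant a c :=
  mul_le_mul (mul_le_mul (fun _ _ => le_rfl) fun x y => by simp) (fun _ _ => le_rfl) a c

/-- For `n = 0` the left-hand side is `|U| |U⁻¹|`, which `majorant ^ 0 = 1` need not dominate. -/
theorem mul_pow_abs_J_mul_le (n : ℕ) (a c : ℕ) :
    mul (mul (abs D.U) (pow (abs D.J) n)) (abs D.V) a c ≤ pow D.majorant (max n 1) a c := by
  have h1 : ∀ n, 1 ≤ n → ∀ a c,
      mul (mul (abs D.U) (pow (abs D.J) n)) (abs D.V) a c ≤ pow D.majorant n a c := by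
    intro n hn
    induction n, hn using Nat.le_induction with
    | base =>
      intro a c
      simpa only [pow, one_mul] using D.abs_U_mul_abs_J_mul_abs_V_le a c
    | succ n _ ih =>
      intro a c
      -- Since `1 ≤ |U⁻¹| |U|`, this factor may be inserted between `|J| ^ n` and `|J|`.
      have h2 : mul (mul (abs D.U) (pow (abs D.J) (n + 1))) (abs D.V) =
          mul (mul (mul (abs D.U) (pow (abs D.J) n)) 1) (mul (abs D.J) (abs D.V)) := by
        rw [mul_one, pow, mul_assoc_ennreal, mul_assoc_ennreal, mul_assoc_ennreal]
      have h3 : mul (mul (mul (abs D.U) (pow (abs D.J) n)) (mul (abs D.V) (abs D.U)))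
          (mul (abs D.J) (abs D.V)) = mul (mul (mul (abs D.U) (pow (abs D.J) n)) (abs D.V))
            (mul (mul (abs D.U) (abs D.J)) (abs D.V)) := by
        simp only [mul_assoc_ennreal]
      rw [h2]
      refine (mul_le_mul (mul_le_mul (fun _ _ => le_rfl) D.one_le_abs_V_mul_abs_U)
        (fun _ _ => le_rfl) a c).trans ?_
      rw [h3, pow]
      exact mul_le_mul ih D.abs_U_mul_abs_J_mul_abs_V_le a c
  rcases Nat.eq_zero_or_pos n with rfl | hn
  · simpa only [pow, mul_one, zero_le, max_eq_right, one_mul] using D.abs_U_mul_abs_V_le a c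
  · rw [max_eq_left hn]
    exact h1 n hn a c

/-- Under absolute convergence, `X ^ n = U J ^ n U⁻¹`. -/
theorem pow_eq (hY : ∀ n a c, pow D.majorant n a c ≠ ∞) (n : ℕ) :
    pow X n = mul (mul D.U (pow D.J n)) D.V := by
  have hUV : mul D.U D.V = 1 := by
    ext a c
    exact (D.U_mul_V a c).tsum_eq
  have hVU : mul D.V D.U = 1 := by
    ext a c
    exact (D.V_mul_U a c).tsum_eq
  have hX : X = mul (mul D.U D.J) D.V := by
    ext a c
    exact (D.eq_conj a c).tsum_eq.symm
  -- A factor `|U⁻¹|` on the right can be dropped from a finiteness claim, as `U⁻¹` has no zero row.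
  have strip : ∀ M : Matrix ℕ D.Index ℝ≥0∞, (∀ a c, mul M (abs D.V) a c ≠ ∞) →
      ∀ a x, M a x ≠ ∞ := by
    intro M hM a x
    obtain ⟨c, hc⟩ := D.exists_abs_V_ne_zero x
    exact ne_top_of_mul_ne_top' (hM a c) hc
  induction n with
  | zero => rw [pow, pow, mul_one, hUV]
  | succ n ih =>
    have hA : ∀ a x, abs (mul D.U (pow D.J n)) a x ≤ mul (abs D.U) (pow (abs D.J) n) a x :=
      fun a x => (abs_mul_le _ _ a x).trans (mul_le_mul (fun _ _ => le_rfl) (D.abs_pow_J_le n) a x)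
    have hAV : ∀ a c, mul (abs (mul D.U (pow D.J n))) (abs D.V) a c ≤
        pow D.majorant (max n 1) a c := fun a c =>
      (mul_le_mul hA (fun _ _ => le_rfl) a c).trans (D.mul_pow_abs_J_mul_le n a c)
    have hAV' : ∀ a c, abs (mul (mul D.U (pow D.J n)) D.V) a c ≤ pow D.majorant (max n 1) a c :=
      fun a c => (abs_mul_le _ _ a c).trans (hAV a c)
    have e1 : mul (mul (mul D.U (pow D.J n)) D.V) (mul (mul D.U D.J) D.V) =
        mul (mul (mul (mul D.U (pow D.J n)) D.V) (mul D.U D.J)) D.V := by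
      refine (mul_assoc_of_ne_top fun a c => ne_top_of_le_ne_top (hY (max n 1 + 1) a c) ?_).symm
      rw [mul_assoc_ennreal, pow]
      refine mul_le_mul hAV' (fun a c => ?_) a c
      exact (mul_le_mul (abs_mul_le _ _) (fun _ _ => le_rfl) a c).trans
        (D.abs_U_mul_abs_J_mul_abs_V_le a c)
    have e2 : mul (mul (mul D.U (pow D.J n)) D.V) (mul D.U D.J) =
        mul (mul (mul (mul D.U (pow D.J n)) D.V) D.U) D.J := by
      refine (mul_assoc_of_ne_top (strip _ fun a c =>
        ne_top_of_le_ne_top (hY (max n 1 + 1) a c) ?_)).symm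
      rw [mul_assoc_ennreal, mul_assoc_ennreal, ← mul_assoc_ennreal (abs D.U), pow]
      exact mul_le_mul hAV' D.abs_U_mul_abs_J_mul_abs_V_le a c
    have e3 : mul (mul (mul D.U (pow D.J n)) D.V) D.U = mul D.U (pow D.J n) := by
      rw [mul_assoc_of_ne_top (strip _ fun a c =>
        ne_top_of_le_ne_top (hY (max n 1 + 1) a c) ?_), hVU, mul_one]
      rw [mul_assoc_ennreal, pow]
      exact mul_le_mul hAV D.abs_U_mul_abs_V_le a c
    have e4 : mul (mul D.U (pow D.J n)) D.J = mul D.U (pow D.J (n + 1)) := by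
      rw [pow]
      refine mul_assoc_of_ne_top (strip _ fun a c =>
        ne_top_of_le_ne_top (hY (max (n + 1) 1) a c) ?_)
      refine le_trans ?_ (D.mul_pow_abs_J_mul_le (n + 1) a c)
      rw [pow, ← mul_assoc_ennreal (abs D.U)]
      exact mul_le_mul (mul_le_mul (mul_le_mul (fun _ _ => le_rfl) (D.abs_pow_J_le n))
        fun _ _ => le_rfl) (fun _ _ => le_rfl) a c
    rw [pow, ih]
    refine (congrArg (mul _) hX).trans ?_
    rw [e1, e2, e3, e4]

end JordanDecomposition

/-! ### Products of powers of several matrices -/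

section Terms

variable {r : ℕ} {R : Fin r → ℝ≥0∞} {f : (Fin r → ℂ) → ℂ} {X : Fin r → Matrix ℕ ℕ ℂ}
  (D : ∀ l, JordanDecomposition (X l))

theorem enorm_prod {ι : Type*} (s : Finset ι) (c : ι → ℂ) : ‖∏ i ∈ s, c i‖ₑ = ∏ i ∈ s, ‖c i‖ₑ := by
  classical
  induction s using Finset.induction_on with
  | empty => simp
  | insert i s hi ih => rw [Finset.prod_insert hi, Finset.prod_insert hi, enorm_mul, ih]

theorem prod_mul_pow_abs_J_mul (n : Fin r → ℕ) (a b : ℕ) :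
    prod (fun l => mul (mul (abs (D l).U) (pow (abs (D l).J) (n l))) (abs (D l).V)) a b =
      ∑' β : ∀ l, (D l).Index, ‖∏ l, (D l).coeff (n l) (β l)‖ₑ *
        prod (fun l => (D l).absComponent (β l)) a b := by
  simp only [JordanDecomposition.mul_pow_abs_J_mul]
  rw [prod_tsum_ennreal]
  refine tsum_congr fun β => ?_
  rw [enorm_prod, ← prod_smul_ennreal]

theorem prod_eq_one {ι R : Type*} [Semiring R] [TopologicalSpace R] [DecidableEq ι]
    {A : Fin r → Matrix ι ι R} (h : ∀ l, A l = 1) : prod A = 1 := by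
  induction r with
  | zero => exact prod_zero A
  | succ r ih => rw [prod_succ, h 0, one_mul, ih fun l => h l.succ]

theorem prod_eq_single {ι R : Type*} [Semiring R] [TopologicalSpace R] [DecidableEq ι]
    {A : Fin r → Matrix ι ι R} (l : Fin r) (h : ∀ l' ≠ l, A l' = 1) : prod A = A l := by
  induction r with
  | zero => exact l.elim0
  | succ r ih =>
    rw [prod_succ]
    induction l using Fin.cases with
    | zero => rw [prod_eq_one fun l => h l.succ (Fin.succ_ne_zero l), mul_one]
    | succ l =>
      rw [h 0 (Fin.succ_ne_zero l).symm, one_mul]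
      exact ih l fun l' hl' => h l'.succ fun e => hl' (Fin.succ_injective _ e)

variable (f) in
/-- The coefficient of `∏ l, component (β l)` in `f (X₁, …, X_r)`: the Taylor coefficient of `f` at
the tuple of eigenvalues. -/
noncomputable def taylorCoeff (β : ∀ l, (D l).Index) : ℂ :=
  mixedDeriv (fun l => ((β l).2 : ℕ)) f (evTuple D fun l => (β l).1) /
    ∏ l, (((β l).2 : ℕ).factorial : ℂ)

theorem hasSum_taylorCoeff (hf : AnalyticOnNhd ℂ f (polydisc R))
    (hev : ∀ l k, ‖(D l).ev k‖ₑ < R l) (β : ∀ l, (D l).Index) :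
    HasSum (fun n : Fin r → ℕ => powerCoeff f n * ∏ l, (D l).coeff (n l) (β l))
      (taylorCoeff f D β) :=
  hasSum_taylor_mixedDeriv hf (z := evTuple D fun l => (β l).1) (fun l => hev l _)
    fun l => ((β l).2 : ℕ)

section Convergence

variable {D}

theorem AbsolutelyConvergent.majorant_ne_top (h : AbsolutelyConvergent f D) (l : Fin r)
    (n a c : ℕ) :
    pow (D l).majorant n a c ≠ ∞ := by
  have h1 := h.1 (Pi.single l n) a c
  rw [prod_eq_single l fun l' hl' => by rw [Pi.single_eq_of_ne hl', pow], Pi.single_eq_same] at h1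
  exact h1

/-- The expansion of a product of powers into the matrices `component`. -/
theorem AbsolutelyConvergent.hasSum_prod_pow (h : AbsolutelyConvergent f D) (n : Fin r → ℕ)
    (a c : ℕ) :
    HasSum (fun β : ∀ l, (D l).Index => (∏ l, (D l).coeff (n l) (β l)) *
      prod (fun l => (D l).component (β l)) a c) (prod (fun l => pow (X l) (n l)) a c) := by
  have h1 := hasSum_prod (fun l (β : (D l).Index) => (D l).coeff (n l) β • (D l).component β)
    (fun l => pow (X l) (n l)) (fun l a c => by
      rw [(D l).pow_eq (h.majorant_ne_top l)]
      exact (D l).hasSum_coeff_smul_component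
        (ne_top_of_le_ne_top (h.majorant_ne_top l _ a c)
          ((D l).mul_pow_abs_J_mul_le (n l) a c))) a c
    (ne_top_of_le_ne_top (h.1 (fun l => max (n l) 1) a c) (prod_le_prod (fun l a c => by
      refine le_trans ?_ ((D l).mul_pow_abs_J_mul_le (n l) a c)
      rw [(D l).mul_pow_abs_J_mul]
      exact ENNReal.tsum_le_tsum fun β => (D l).abs_coeff_smul_component_le (n l) β a c) a c))
  refine hasSum_congr_fun h1 fun β => ?_
  rw [prod_smul]

/-- Summation over `n` first in the double series turns the power series of `f` into its Taylor
coefficients at the eigenvalues. -/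
theorem AbsolutelyConvergent.hasSum_and_summable (h : AbsolutelyConvergent f D)
    (hf : AnalyticOnNhd ℂ f (polydisc R)) (hev : ∀ l k, ‖(D l).ev k‖ₑ < R l) (a c : ℕ) :
    Summable (fun β : ∀ l, (D l).Index =>
      taylorCoeff f D β * prod (fun l => (D l).component (β l)) a c) ∧
    HasSum (fun n : Fin r → ℕ => powerCoeff f n * prod (fun l => pow (X l) (n l)) a c)
      (∑' β : ∀ l, (D l).Index,
        taylorCoeff f D β * prod (fun l => (D l).component (β l)) a c) := by
  have hs : Summable fun p : (Fin r → ℕ) × ∀ l, (D l).Index =>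
      powerCoeff f p.1 * ((∏ l, (D l).coeff (p.1 l) (p.2 l)) *
        prod (fun l => (D l).component (p.2 l)) a c) := by
    refine summable_of_tsum_enorm_ne_top (ne_top_of_le_ne_top (h.2 a c) ?_)
    rw [ENNReal.tsum_prod']
    refine ENNReal.tsum_le_tsum fun n => ?_
    rw [prod_mul_pow_abs_J_mul, ← ENNReal.tsum_mul_left]
    refine ENNReal.tsum_le_tsum fun β => ?_
    dsimp only
    rw [enorm_mul, enorm_mul]
    gcongr
    exact (abs_prod_le _ a c).trans
      (prod_le_prod (fun l a c => (D l).abs_component_le (β l) a c) a c)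
  have h1 := hs.hasSum.prod_fiberwise fun n => (h.hasSum_prod_pow n a c).mul_left (powerCoeff f n)
  have h2 := ((Equiv.prodComm _ _).hasSum_iff.2 hs.hasSum).prod_fiberwise
    (g := fun β => taylorCoeff f D β * prod (fun l => (D l).component (β l)) a c) fun β => by
      refine hasSum_congr_fun ((hasSum_taylorCoeff D hf hev β).mul_right _) fun n => ?_
      exact mul_assoc _ _ _
  rw [h2.tsum_eq]
  exact ⟨h2.summable, h1⟩

end Convergence

/-! ### The closed form -/

/-- Regrouping of the positions `⟨b l, q l⟩` of the Jordan bases into blocks and positions in the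
blocks. -/
def indexEquiv : (Σ b : ∀ l, (D l).Block, ∀ l, Fin ((D l).size (b l))) ≃ ∀ l, (D l).Index where
  toFun p l := ⟨p.1 l, p.2 l⟩
  invFun β := ⟨fun l => (β l).1, fun l => (β l).2⟩
  left_inv _ := rfl
  right_inv _ := rfl

/-- The set of the variables `l` with a nilpotent factor, i.e. with position `q l ≠ 0`. -/
def nilpotentSet {b : ∀ l, (D l).Block} (q : ∀ l, Fin ((D l).size (b l))) : Finset (Fin r) :=
  Finset.univ.filter fun l => (q l : ℕ) ≠ 0

/-- `selectionTerm` as the part of the sum over the positions in the blocks with a prescribed set of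
nilpotent factors. -/
theorem selectionTerm_apply (b : ∀ l, (D l).Block) (S : Finset (Fin r)) (a c : ℕ) :
    selectionTerm f D b S a c = ∑ q : ∀ l, Fin ((D l).size (b l)),
      if nilpotentSet D q = S then taylorCoeff f D (indexEquiv D ⟨b, q⟩) *
        prod (fun l => (D l).component (indexEquiv D ⟨b, q⟩ l)) a c else 0 := by
  rw [← Finset.sum_filter, selectionTerm, Matrix.sum_apply]
  symm
  refine Finset.sum_bij (fun q _ l => (q l : ℕ)) ?_ ?_ ?_ ?_
  · intro q hq
    obtain rfl : nilpotentSet D q = S := by simpa using hq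
    rw [Fintype.mem_piFinset]
    intro l
    by_cases h : (q l : ℕ) = 0
    · simp [nilpotentSet, h]
    · have := (q l).isLt
      simp only [nilpotentSet, Finset.mem_filter, Finset.mem_univ, true_and, ne_eq, h,
        not_false_eq_true, if_true, Finset.mem_Icc]
      omega
  · intro q _ q' _ h
    ext l
    exact congrFun h l
  · intro q hq
    rw [Fintype.mem_piFinset] at hq
    have hlt : ∀ l, q l < (D l).size (b l) := by
      intro l
      have h1 := hq l
      have h2 := (D l).size_pos (b l)
      by_cases h : l ∈ S
      · rw [if_pos h, Finset.mem_Icc] at h1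
        omega
      · rw [if_neg h, Finset.mem_singleton] at h1
        omega
    refine ⟨fun l => ⟨q l, hlt l⟩, ?_, rfl⟩
    rw [Finset.mem_filter]
    refine ⟨Finset.mem_univ _, ?_⟩
    ext l
    have h1 := hq l
    by_cases h : l ∈ S
    · rw [if_pos h, Finset.mem_Icc] at h1
      simp only [nilpotentSet, Finset.mem_filter, Finset.mem_univ, true_and, h, iff_true]
      omega
    · rw [if_neg h, Finset.mem_singleton] at h1
      simp [nilpotentSet, h, h1]
  · intro q hq
    obtain rfl : nilpotentSet D q = S := by simpa using hq
    rw [Matrix.smul_apply, smul_eq_mul, taylorCoeff]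
    congr 2
    · refine (Finset.prod_subset (Finset.subset_univ _) fun l _ hl => ?_).symm
      have : (q l : ℕ) = 0 := by simpa [nilpotentSet] using hl
      simp [indexEquiv, this]
    · funext l
      by_cases h : (q l : ℕ) = 0
      · have : l ∉ nilpotentSet D q := by simp [nilpotentSet, h]
        rw [if_neg this, (D l).P_eq]
        simp only [JordanDecomposition.component, indexEquiv, Equiv.coe_fn_mk, h]
      · have : l ∈ nilpotentSet D q := by simp [nilpotentSet, h]
        rw [if_pos this, (D l).pow_N _ (Nat.one_le_iff_ne_zero.2 h)]
        rfl

theorem projectorTerm_eq (b : ∀ l, (D l).Block) : projectorTerm f D b = selectionTerm f D b ∅ := by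
  have h : (Fintype.piFinset fun _ : Fin r => ({0} : Finset ℕ)) = {0} := by
    ext q
    simp [funext_iff]
  have h0 : mixedDeriv 0 f = f := by
    unfold mixedDeriv
    induction List.finRange r with
    | nil => rfl
    | cons l L ih => exact ih
  simp only [selectionTerm, projectorTerm, Finset.notMem_empty, if_false, h,
    Finset.sum_singleton, Finset.prod_empty, div_one, h0]

theorem nilpotentTerm_eq (b : ∀ l, (D l).Block) :
    nilpotentTerm f D b = selectionTerm f D b Finset.univ := by
  simp only [selectionTerm, nilpotentTerm, Finset.mem_univ, if_true]

theorem projectorTerm_add_mixedTerm_add_nilpotentTerm (hr : 1 ≤ r) (b : ∀ l, (D l).Block) :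
    projectorTerm f D b + mixedTerm f D b + nilpotentTerm f D b =
      ∑ S : Finset (Fin r), selectionTerm f D b S := by
  rw [← Finset.powerset_univ, Finset.sum_powerset, Finset.card_univ, Fintype.card_fin,
    projectorTerm_eq, nilpotentTerm_eq, mixedTerm]
  obtain ⟨r, rfl⟩ := Nat.exists_eq_add_of_le' hr
  have hu : Finset.powersetCard (r + 1) (Finset.univ : Finset (Fin (r + 1))) = {Finset.univ} := by
    simpa using Finset.powersetCard_self (Finset.univ : Finset (Fin (r + 1)))
  have hI : Finset.Icc 1 (r + 1 - 1) = Finset.Ico 1 (r + 1) := by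
    ext; simp
  rw [Finset.sum_range_succ, hu, Finset.sum_singleton, hI, Finset.range_eq_Ico,
    Finset.sum_eq_sum_Ico_succ_bot (Nat.succ_pos r), Finset.powersetCard_zero,
    Finset.sum_singleton]

theorem hasSum_matrix {γ ι κ : Type*} {F : γ → Matrix ι κ ℂ} {M : Matrix ι κ ℂ}
    (h : ∀ a c, HasSum (fun x => F x a c) (M a c)) : HasSum F M :=
  Pi.hasSum.2 fun a => Pi.hasSum.2 fun c => h a c

variable {D}

theorem AbsolutelyConvergent.summable_selectionTerm (h : AbsolutelyConvergent f D)
    (hf : AnalyticOnNhd ℂ f (polydisc R)) (hev : ∀ l k, ‖(D l).ev k‖ₑ < R l)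
    (S : Finset (Fin r)) :
    Summable fun b : ∀ l, (D l).Block => selectionTerm f D b S := by
  refine Pi.summable.2 fun a => Pi.summable.2 fun c => ?_
  have h1 := ((indexEquiv D).summable_iff.2 (h.hasSum_and_summable hf hev a c).1).indicator
    {p | nilpotentSet D p.2 = S}
  refine h1.sigma.congr fun b => ?_
  rw [tsum_fintype]
  refine Eq.trans (Finset.sum_congr rfl fun q _ => ?_) (selectionTerm_apply D b S a c).symm
  by_cases hq : nilpotentSet D q = S <;> simp [Set.indicator, hq]

theorem AbsolutelyConvergent.hasSum_sum_selectionTerm (h : AbsolutelyConvergent f D)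
    (hf : AnalyticOnNhd ℂ f (polydisc R)) (hev : ∀ l k, ‖(D l).ev k‖ₑ < R l) :
    HasSum (fun b : ∀ l, (D l).Block => ∑ S : Finset (Fin r), selectionTerm f D b S)
      (fun a c => ∑' β : ∀ l, (D l).Index,
        taylorCoeff f D β * prod (fun l => (D l).component (β l)) a c : Matrix ℕ ℕ ℂ) := by
  refine hasSum_matrix fun a c => ?_
  have h1 := ((indexEquiv D).hasSum_iff.2 (h.hasSum_and_summable hf hev a c).1.hasSum).sigma
    fun b => hasSum_fintype _
  refine hasSum_congr_fun h1 fun b => ?_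
  rw [Matrix.sum_apply]
  simp only [selectionTerm_apply]
  rw [Finset.sum_comm]
  refine Finset.sum_congr rfl fun q _ => ?_
  rw [Finset.sum_ite_eq, if_pos (Finset.mem_univ _)]
  rfl

theorem AbsolutelyConvergent.hasMatrixValue (h : AbsolutelyConvergent f D) (hr : 1 ≤ r)
    (hf : AnalyticOnNhd ℂ f (polydisc R)) (hev : ∀ l k, ‖(D l).ev k‖ₑ < R l) :
    Summable (fun b : ∀ l, (D l).Block => projectorTerm f D b) ∧
    Summable (fun b : ∀ l, (D l).Block => mixedTerm f D b) ∧
    Summable (fun b : ∀ l, (D l).Block => nilpotentTerm f D b) ∧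
    HasMatrixValue f X
      ((∑' b : ∀ l, (D l).Block, projectorTerm f D b) +
        (∑' b : ∀ l, (D l).Block, mixedTerm f D b) +
        (∑' b : ∀ l, (D l).Block, nilpotentTerm f D b)) := by
  have hS := h.summable_selectionTerm hf hev
  have h1 : Summable fun b : ∀ l, (D l).Block => projectorTerm f D b := by
    simpa only [projectorTerm_eq] using hS ∅
  have h2 : Summable fun b : ∀ l, (D l).Block => mixedTerm f D b :=
    summable_sum fun κ _ => summable_sum fun S _ => hS S
  have h3 : Summable fun b : ∀ l, (D l).Block => nilpotentTerm f D b := by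
    simpa only [nilpotentTerm_eq] using hS Finset.univ
  refine ⟨h1, h2, h3, ?_⟩
  have h4 := (h1.hasSum.add h2.hasSum).add h3.hasSum
  simp only [projectorTerm_add_mixedTerm_add_nilpotentTerm D hr] at h4
  rw [h4.unique (h.hasSum_sum_selectionTerm hf hev)]
  exact hasSum_matrix fun a c => (h.hasSum_and_summable hf hev a c).2

end Terms

/-! ### Column-finite and row-finite matrices -/

/-- A family of matrices with finite entries such that, for every column, only finitely many entries
in that column, over all the members of the family, are nonzero. -/
def ColFinFamily {β ι κ : Type*} (A : β → Matrix ι κ ℝ≥0∞) : Prop :=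
  (∀ x a b, A x a b ≠ ∞) ∧ ∀ b, {p : β × ι | A p.1 p.2 b ≠ 0}.Finite

namespace ColFinFamily

variable {β γ ι κ ν : Type*}

theorem comp_injective {A : β → Matrix ι κ ℝ≥0∞} (hA : ColFinFamily A) {e : γ → β}
    (he : Injective e) : ColFinFamily fun x => A (e x) :=
  ⟨fun x => hA.1 (e x), fun b => (hA.2 b).preimage
    (f := Prod.map e id) ((he.prodMap injective_id).injOn)⟩

theorem mul {A : β → Matrix ι κ ℝ≥0∞} {B : γ → Matrix κ ν ℝ≥0∞} (hA : ColFinFamily A)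
    (hB : ColFinFamily B) : ColFinFamily fun p : β × γ => mul (A p.1) (B p.2) := by
  constructor
  · rintro ⟨x, y⟩ a b
    have hfin : {c | B y c b ≠ 0}.Finite := (hB.2 b).preimage (f := fun c => (y, c))
      (fun c _ c' _ h => by simpa using h)
    have h0 : ∀ c ∉ hfin.toFinset, A x a c * B y c b = 0 := fun c hc => by
      have : B y c b = 0 := by simpa using hc
      rw [this, MulZeroClass.mul_zero]
    dsimp only
    rw [InfMat.mul, tsum_eq_sum h0]
    exact ENNReal.sum_ne_top.2 fun c _ => ENNReal.mul_ne_top (hA.1 x a c) (hB.1 y c b)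
  · intro b
    refine Set.Finite.subset ((hB.2 b).biUnion fun q _ =>
      (hA.2 q.2).image fun p : β × ι => ((p.1, q.1), p.2)) ?_
    rintro ⟨⟨x, y⟩, a⟩ h
    obtain ⟨c, hc⟩ : ∃ c, A x a c * B y c b ≠ 0 := by
      by_contra! h0
      exact h (ENNReal.tsum_eq_zero.2 h0)
    exact Set.mem_biUnion (x := (y, c)) (right_ne_zero_of_mul hc)
      ⟨(x, a), left_ne_zero_of_mul hc, rfl⟩

end ColFinFamily

/-- The analogue of `ColFinFamily` for rows. -/
def RowFinFamily {β ι κ : Type*} (A : β → Matrix ι κ ℝ≥0∞) : Prop :=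
  ColFinFamily fun x => (A x).transpose

theorem transpose_mul {ι κ ν : Type*} (A : Matrix ι κ ℝ≥0∞) (B : Matrix κ ν ℝ≥0∞) :
    (mul A B).transpose = mul B.transpose A.transpose := by
  ext a b
  simp [mul, mul_comm]

theorem RowFinFamily.mul {β γ ι κ ν : Type*} {A : β → Matrix ι κ ℝ≥0∞} {B : γ → Matrix κ ν ℝ≥0∞}
    (hA : RowFinFamily A) (hB : RowFinFamily B) :
    RowFinFamily fun p : β × γ => mul (A p.1) (B p.2) := by
  have h := (ColFinFamily.mul hB hA).comp_injective (e := Prod.swap) Prod.swap_injective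
  simp only [RowFinFamily, transpose_mul]
  exact h

theorem colFinFamily_one {ι : Type*} [DecidableEq ι] {β : Type*} [Finite β] :
    ColFinFamily fun _ : β => (1 : Matrix ι ι ℝ≥0∞) := by
  refine ⟨fun _ a b => ?_, fun b => ?_⟩
  · by_cases h : a = b <;> simp [Matrix.one_apply, h]
  · refine (Set.finite_univ.prod (Set.finite_singleton b)).subset fun p hp => ?_
    by_contra h
    have : p.2 ≠ b := by simpa using h
    exact hp (by simp [this])

theorem rowFinFamily_one {ι : Type*} [DecidableEq ι] {β : Type*} [Finite β] :
    RowFinFamily fun _ : β => (1 : Matrix ι ι ℝ≥0∞) := by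
  simpa only [RowFinFamily, Matrix.transpose_one] using colFinFamily_one

/-- The properties of `ColFinFamily` and `RowFinFamily` which carry over to ordered products. -/
structure FinitenessClass (Q : ∀ β : Type, (β → Matrix ℕ ℕ ℝ≥0∞) → Prop) : Prop where
  one : ∀ {β : Type} [Finite β], Q β fun _ => 1
  mul : ∀ {β γ : Type} {A : β → Matrix ℕ ℕ ℝ≥0∞} {B : γ → Matrix ℕ ℕ ℝ≥0∞}, Q β A → Q γ B →
    Q (β × γ) fun p => mul (A p.1) (B p.2)
  comp : ∀ {β γ : Type} {A : β → Matrix ℕ ℕ ℝ≥0∞} {e : γ → β}, Q β A → Injective e →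
    Q γ fun x => A (e x)
  ne_top : ∀ {β : Type} {A : β → Matrix ℕ ℕ ℝ≥0∞}, Q β A → ∀ x a b, A x a b ≠ ∞
  finite : ∀ {β : Type} {A : β → Matrix ℕ ℕ ℝ≥0∞}, Q β A → ∀ a b, {x | A x a b ≠ 0}.Finite

theorem finitenessClass_col : FinitenessClass fun _ A => ColFinFamily A where
  one := colFinFamily_one
  mul := ColFinFamily.mul
  comp h he := ColFinFamily.comp_injective h he
  ne_top h := h.1
  finite h a b := (h.2 b).preimage (f := fun x => (x, a)) fun x _ y _ h => by simpa using h

theorem finitenessClass_row : FinitenessClass fun _ A => RowFinFamily A where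
  one := rowFinFamily_one
  mul := RowFinFamily.mul
  comp h he := ColFinFamily.comp_injective h he
  ne_top h x a b := h.1 x b a
  finite h a b := (h.2 a).preimage (f := fun x => (x, b)) fun x _ y _ h => by simpa using h

namespace FinitenessClass

variable {Q : ∀ β : Type, (β → Matrix ℕ ℕ ℝ≥0∞) → Prop}

theorem pow (hQ : FinitenessClass Q) {A : Matrix ℕ ℕ ℝ≥0∞} (hA : Q Unit fun _ => A) (n : ℕ) :
    Q Unit fun _ => pow A n := by
  induction n with
  | zero => exact hQ.one
  | succ n ih => exact hQ.comp (hQ.mul ih hA) (e := fun _ : Unit => ((), ())) fun _ _ _ => rfl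

theorem prod (hQ : FinitenessClass Q) {r : ℕ} {β : Fin r → Type} {A : ∀ l, β l → Matrix ℕ ℕ ℝ≥0∞}
    (hA : ∀ l, Q (β l) (A l)) :
    Q (∀ l, β l) fun x => prod fun l => A l (x l) := by
  induction r with
  | zero =>
    simp only [prod_zero]
    exact hQ.one
  | succ r ih =>
    simp only [prod_succ]
    exact hQ.comp (hQ.mul (hA 0) (ih fun l => hA l.succ)) (Fin.consEquiv β).symm.injective

/-- Every entry of the second series of `AbsolutelyConvergent` is, after an exchange of summations,
a finite combination of the sums `∑' n, |aₙ ∏ coeff (n l) (β l)|`, which are finite by the Taylor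
expansion at the eigenvalues. -/
theorem absolutelyConvergent (hQ : FinitenessClass Q) {r : ℕ} {R : Fin r → ℝ≥0∞}
    {f : (Fin r → ℂ) → ℂ}
    {X : Fin r → Matrix ℕ ℕ ℂ} {D : ∀ l, JordanDecomposition (X l)}
    (hf : AnalyticOnNhd ℂ f (polydisc R)) (hev : ∀ l k, ‖(D l).ev k‖ₑ < R l)
    (h1 : ∀ l, Q Unit fun _ => (D l).majorant) (h2 : ∀ l, Q (D l).Index (D l).absComponent) :
    AbsolutelyConvergent f D := by
  refine ⟨fun n a b => hQ.ne_top (hQ.prod fun l => hQ.pow (h1 l) (n l)) (fun _ => ()) a b,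
    fun a b => ?_⟩
  have h3 := hQ.prod h2
  simp only [prod_mul_pow_abs_J_mul, ← ENNReal.tsum_mul_left]
  rw [ENNReal.tsum_comm]
  have h0 : ∀ β ∉ (hQ.finite h3 a b).toFinset, ∑' n : Fin r → ℕ, ‖powerCoeff f n‖ₑ *
      (‖∏ l, (D l).coeff (n l) (β l)‖ₑ *
        InfMat.prod (fun l => (D l).absComponent (β l)) a b) = 0 := by
    intro β hβ
    have : InfMat.prod (fun l => (D l).absComponent (β l)) a b = 0 := by simpa using hβ
    simp [this]
  rw [tsum_eq_sum h0]
  refine ENNReal.sum_ne_top.2 fun β _ => ?_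
  simp only [← mul_assoc, ← enorm_mul]
  rw [ENNReal.tsum_mul_right]
  exact ENNReal.mul_ne_top (tsum_enorm_ne_top (hasSum_taylorCoeff D hf hev β).summable)
    (hQ.ne_top h3 β a b)

end FinitenessClass

namespace JordanDecomposition

variable {X : Matrix ℕ ℕ ℂ} (D : JordanDecomposition X)

theorem absComponent_ne_top (β : D.Index) (a c : ℕ) : D.absComponent β a c ≠ ∞ := by
  have h : ∀ x y, (shift ℝ≥0∞ (D.size β.1) β.2) x y ≠ ∞ := fun x y => by
    rw [← enorm_shift]
    exact enorm_ne_top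
  unfold absComponent sandwich
  exact ENNReal.sum_ne_top.2 fun j _ => ENNReal.mul_ne_top (ENNReal.sum_ne_top.2 fun i _ =>
    ENNReal.mul_ne_top (enorm_ne_top (x := D.U a _)) (h i j)) (enorm_ne_top (x := D.V _ c))

theorem exists_of_absComponent_ne_zero {β : D.Index} {a c : ℕ} (h : D.absComponent β a c ≠ 0) :
    ∃ i j, D.U a ⟨β.1, i⟩ ≠ 0 ∧ D.V ⟨β.1, j⟩ c ≠ 0 := by
  unfold absComponent sandwich at h
  obtain ⟨j, _, hj⟩ := Finset.exists_ne_zero_of_sum_ne_zero h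
  have h' := left_ne_zero_of_mul hj
  obtain ⟨i, _, hi⟩ := Finset.exists_ne_zero_of_sum_ne_zero h'
  exact ⟨i, j, by simpa [abs] using left_ne_zero_of_mul hi,
    by simpa [abs] using right_ne_zero_of_mul hj⟩

theorem one_add_abs_J_ne_top (x y : D.Index) : (1 + abs D.J) x y ≠ ∞ := by
  rw [Matrix.add_apply]
  refine ENNReal.add_ne_top.2 ⟨?_, enorm_ne_top⟩
  by_cases h : x = y <;> simp [Matrix.one_apply, h]

theorem fst_eq_of_one_add_abs_J_ne_zero {x y : D.Index} (h : (1 + abs D.J) x y ≠ 0) :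
    x.1 = y.1 := by
  by_contra hne
  refine h ?_
  obtain ⟨b, i⟩ := x
  obtain ⟨b', j⟩ := y
  have h1 : (⟨b, i⟩ : D.Index) ≠ ⟨b', j⟩ := fun e => hne (congrArg Sigma.fst e)
  rw [Matrix.add_apply, Matrix.one_apply_ne h1, abs, Matrix.map_apply, J,
    Matrix.blockDiagonal'_apply_ne _ _ _ hne, enorm_zero, add_zero]

theorem finite_block (b : D.Block) : {x : D.Index | x.1 = b}.Finite := by
  refine (Set.finite_range (Sigma.mk b)).subset ?_
  rintro ⟨b', i⟩ rfl
  exact ⟨i, rfl⟩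

theorem colFinFamily_abs {ι κ : Type*} {A : Matrix ι κ ℂ} (h : ColumnFinite A) :
    ColFinFamily fun _ : Unit => abs A :=
  ⟨fun _ _ _ => enorm_ne_top, fun b => ((h b).image fun a => ((), a)).subset
    fun p hp => ⟨p.2, by simpa [abs] using hp, rfl⟩⟩

theorem colFinFamily_one_add_abs_J : ColFinFamily fun _ : Unit => 1 + abs D.J :=
  ⟨fun _ => D.one_add_abs_J_ne_top, fun y => ((D.finite_block y.1).image fun x => ((), x)).subset
    fun p hp => ⟨p.2, D.fst_eq_of_one_add_abs_J_ne_zero hp, rfl⟩⟩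

theorem rowFinFamily_one_add_abs_J : RowFinFamily fun _ : Unit => 1 + abs D.J :=
  ⟨fun _ x y => D.one_add_abs_J_ne_top y x,
    fun y => ((D.finite_block y.1).image fun x => ((), x)).subset
      fun p hp => ⟨p.2, (D.fst_eq_of_one_add_abs_J_ne_zero hp).symm, rfl⟩⟩

theorem colFinFamily_majorant (hU : ColumnFinite D.U) (hV : ColumnFinite D.V) :
    ColFinFamily fun _ : Unit => D.majorant :=
  (((colFinFamily_abs hU).mul D.colFinFamily_one_add_abs_J).mul
    (colFinFamily_abs hV)).comp_injective (e := fun _ : Unit => (((), ()), ())) fun _ _ _ => rfl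

theorem rowFinFamily_majorant (hU : RowFinite D.U) (hV : RowFinite D.V) :
    RowFinFamily fun _ : Unit => D.majorant := by
  have hU' : RowFinFamily fun _ : Unit => abs D.U := colFinFamily_abs (A := D.U.transpose) hU
  have hV' : RowFinFamily fun _ : Unit => abs D.V := colFinFamily_abs (A := D.V.transpose) hV
  exact ColFinFamily.comp_injective ((hU'.mul D.rowFinFamily_one_add_abs_J).mul hV')
    (e := fun _ : Unit => (((), ()), ())) fun _ _ _ => rfl

theorem colFinFamily_absComponent (hU : ColumnFinite D.U) (hV : ColumnFinite D.V) :
    ColFinFamily D.absComponent := by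
  refine ⟨D.absComponent_ne_top, fun c => ?_⟩
  refine Set.Finite.subset ((hV c).biUnion fun x _ => (D.finite_block x.1).biUnion fun β _ =>
    (D.finite_block x.1).biUnion fun y _ => (hU y).image fun a => (β, a)) ?_
  rintro ⟨β, a⟩ h
  obtain ⟨i, j, hi, hj⟩ := D.exists_of_absComponent_ne_zero h
  simp only [Set.mem_iUnion]
  exact ⟨⟨β.1, j⟩, hj, β, rfl, ⟨β.1, i⟩, rfl, a, hi, rfl⟩

theorem rowFinFamily_absComponent (hU : RowFinite D.U) (hV : RowFinite D.V) :
    RowFinFamily D.absComponent := by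
  refine ⟨fun β a c => D.absComponent_ne_top β c a, fun a => ?_⟩
  refine Set.Finite.subset ((hU a).biUnion fun x _ => (D.finite_block x.1).biUnion fun β _ =>
    (D.finite_block x.1).biUnion fun y _ => (hV y).image fun c => (β, c)) ?_
  rintro ⟨β, c⟩ h
  obtain ⟨i, j, hi, hj⟩ := D.exists_of_absComponent_ne_zero h
  simp only [Set.mem_iUnion]
  exact ⟨⟨β.1, i⟩, hi, β, rfl, ⟨β.1, j⟩, rfl, c, hj, rfl⟩

end JordanDecomposition

end InfMat

theorem mainTheorem3 (r : ℕ) (hr : 1 ≤ r) (R : Fin r → ℝ≥0∞) (f : (Fin r → ℂ) → ℂ)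
    (hf : AnalyticOnNhd ℂ f {z | ∀ l, ‖z l‖ₑ < R l})
    (X : Fin r → Matrix ℕ ℕ ℂ) (D : ∀ l, InfMat.JordanDecomposition (X l))
    (hev : ∀ l k, ‖(D l).ev k‖ₑ < R l) :
    (((∀ l, InfMat.ColumnFinite (D l).U ∧ InfMat.ColumnFinite (D l).V) ∨
        (∀ l, InfMat.RowFinite (D l).U ∧ InfMat.RowFinite (D l).V)) →
      InfMat.AbsolutelyConvergent f D) ∧
    (InfMat.AbsolutelyConvergent f D →
      Summable (fun b : ∀ l, (D l).Block => InfMat.projectorTerm f D b) ∧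
      Summable (fun b : ∀ l, (D l).Block => InfMat.mixedTerm f D b) ∧
      Summable (fun b : ∀ l, (D l).Block => InfMat.nilpotentTerm f D b) ∧
      InfMat.HasMatrixValue f X
        ((∑' b : ∀ l, (D l).Block, InfMat.projectorTerm f D b) +
          (∑' b : ∀ l, (D l).Block, InfMat.mixedTerm f D b) +
          (∑' b : ∀ l, (D l).Block, InfMat.nilpotentTerm f D b))) := by
  refine ⟨?_, fun h => h.hasMatrixValue hr hf hev⟩
  rintro (h | h)
  · exact InfMat.finitenessClass_col.absolutelyConvergent hf hev
      (fun l => (D l).colFinFamily_majorant (h l).1 (h l).2)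
      fun l => (D l).colFinFamily_absComponent (h l).1 (h l).2
  · exact InfMat.finitenessClass_row.absolutelyConvergent hf hev
      (fun l => (D l).rowFinFamily_majorant (h l).1 (h l).2)
      fun l => (D l).rowFinFamily_absComponent (h l).1 (h l).2
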